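/- Let $F_2$ be the free group on $a,b$. Put $S_{0ab}=S_{0ba}=\emptyset$ and, for $k\ge 1$, $$S_{kab}=S_{(k-1)ab}\cup a^{2^{k-1}}S_{(k-1)ab}a^{-2^{k-1}}\cup a^{2^{k-1}}\big(\{b^{2^{k-1}}\}\cup S_{(k-1)ba}\big)a^{-2^{k-1}},$$ $$S_{kba}=S_{(k-1)ba}\cup b^{2^{k-1}}S_{(k-1)ba}b^{-2^{k-1}}\cup b^{2^{k-1}}\big(\{a^{2^{k-1}}\}\cup S_{(k-1)ab}\big)b^{-2^{k-1}},$$ and for $k\ge 0$ let $G_k=\langle a^{2^k},b^{2^k},S_{kab},S_{kba}\rangle\subset F_2$, so that $G_{k+1}\subset G_k$. Let $\Lambda_k$ be the topological graph (the Schreier diagram of $(F_2,G_k)$) whose vertices are the cosets $G_kg$, with one edge from $G_kg$ to $G_kgs$ for each coset and each $s\in\{a,b\}$. Let $\Lambda_{k+1}\to\Lambda_k$ be the map induced by $G_{k+1}g\mapsto G_kg$ that preserves the labels of edges. The Schreier continuum of the Schori solenoid (with the loops at the vertices given by the other two generators of the surface group removed) is the inverse limit $\Lambda=\varprojlim\Lambda_k$.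 A vertex of $\Lambda$ is a point $v=(v_k)$ all of whose coordinates are vertices. For $v\in\Lambda$ let $L_v$ be the path component of $v$ in $\Lambda$, equipped with the leaf topology (generated by the path components of the open subsets of $\Lambda$). Let $\mathrm{id}_k$ and $a^i$, $b^i$ denote the cosets of $1$, $a^i$ and $b^i$ in $\Lambda_k$, and let $\mathrm{id}=(\mathrm{id}_k)\in\Lambda$. For $k\ge1$ let $\mathcal A_k$ be the path component of $\Lambda_k\setminus\{\mathrm{id}_k\}$ that contains $a^1,\dots,a^{2^k-1}$. For $k\ge1$ the set $\mathcal A_{k+1}\setminus\{a^{2^k}\}$ has three path components: one that contains the $a^i$ with $0<i<2^k$, one that contains the $a^i$ with $2^k<i<2^{k+1}$, and a remaining one, which is denoted by $\mathcal{TA}_{k+1}$. The set $\mathcal{TB}_{k+1}$ is defined in the same way with $a$ and $b$ exchanged. A vertex $v=(v_k)$ of $\Lambda$ with $v\notin L_{\mathrm{id}}$ is called dyadic if $v_k\in\mathcal{TA}_k\cup\mathcal{TB}_k$ for at most finitely many $k$. **Lemma.** If $v$ is a dyadic vertex of $\Lambda$, then $L_v$ has exactly $2$ ends. Here the ends of a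 space $X$ are defined by means of compact sets $K_0\subset K_1\subset\cdots$ with $K_i\subset\operatorname{int}K_{i+1}$ and $\bigcup_iK_i=X$. They are the classes of chains $U_0\supset U_1\supset\cdots$, where $U_i$ is a connected component of $X\setminus K_i$ that is contained in no compact set and $\bigcap_iU_i=\emptyset$. Two chains $(U_i)$ and $(V_i)$ are equivalent if for every $i$ there is $j>i$ with $U_j\cup V_j\subset U_i\cap V_i$. The lemma asserts that such sequences $(K_i)$ exist for $X=L_v$ and that each of them gives exactly $2$ ends. -/

import Mathlib

open Set Topology

/-! ## Ends of a topological space -/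

namespace SpaceEnds

/-- A chain of unbounded connected components of the complements of the members of an exhaustion
`K 0 ⊆ K 1 ⊆ ...` by compact sets.  Mathlib's `CompactExhaustion` asks for
`K i ⊆ interior (K (i + 1))` and `⋃ i, K i = X`.  Unbounded means: contained in no compact set. -/
structure Chain {X : Type*} [TopologicalSpace X] (K : CompactExhaustion X) where
  U : ℕ → Set X
  isComponent : ∀ i, ∃ x ∈ (K i)ᶜ, U i = connectedComponentIn (K i)ᶜ x
  unbounded : ∀ i, ¬ ∃ C : Set X, IsCompact C ∧ U i ⊆ C
  anti : ∀ i, U (i + 1) ⊆ U i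
  iInter_eq_empty : ⋂ i, U i = ∅

theorem Chain.antitone {X : Type*} [TopologicalSpace X] {K : CompactExhaustion X}
    (c : Chain K) : Antitone c.U :=
  antitone_nat_of_succ_le c.anti

/-- Two chains `U`, `V` are equivalent if for every `i` there is `j > i` with
`U j ∪ V j ⊆ U i ∩ V i`. -/
def chainSetoid {X : Type*} [TopologicalSpace X] (K : CompactExhaustion X) : Setoid (Chain K) where
  r c d := ∀ i, ∃ j, i < j ∧ c.U j ∪ d.U j ⊆ c.U i ∩ d.U i
  iseqv :=
    { refl := fun c i => ⟨i + 1, Nat.lt_succ_self i, by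
        rw [union_self, inter_self]; exact c.anti i⟩
      symm := fun {c d} h i => by
        obtain ⟨j, hj, hs⟩ := h i
        exact ⟨j, hj, by rwa [union_comm, inter_comm]⟩
      trans := fun {c d e} h₁ h₂ i => by
        obtain ⟨j, hj, hs⟩ := h₁ i
        obtain ⟨l, hl, ht⟩ := h₂ i
        obtain ⟨m, hm, hu⟩ := h₂ j
        obtain ⟨n, hn, hw⟩ := h₁ l
        refine ⟨max m n, by omega, union_subset (subset_inter ?_ ?_) (subset_inter ?_ ?_)⟩
        · exact c.antitone (by omega)
        · exact fun x hx => (ht (Or.inl (hw (Or.inl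
            (c.antitone (le_max_right m n) hx))).2)).2
        · exact fun x hx => (hs (Or.inr (hu (Or.inr
            (e.antitone (le_max_left m n) hx))).1)).1
        · exact e.antitone (by omega) }

/-- The set of ends of `X`, computed with the exhaustion `K`. -/
def Ends {X : Type*} [TopologicalSpace X] (K : CompactExhaustion X) : Type _ :=
  Quotient (chainSetoid K)

end SpaceEnds

/-- The leaf topology of a space: the open sets are generated by the path components of the open
sets.  On a space that is locally a product of a locally path-connected space `P` and a totally
disconnected space `Z`, it is generated by the slices `V × {z}`, with `V` open in `P`. -/
def leafTopology (X : Type*) [TopologicalSpace X] : TopologicalSpace X :=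
  TopologicalSpace.generateFrom {S | ∃ U : Set X, IsOpen U ∧ ∃ x ∈ U, S = pathComponentIn U x}

/-! ## The Schreier continuum of the Schori solenoid -/

namespace Schori

/-- The two generators of the free group `F₂`. -/
inductive Letter : Type
  | a
  | b

/-- The other letter. -/
def Letter.other : Letter → Letter
  | .a => .b
  | .b => .a

instance : TopologicalSpace Letter := ⊥

instance : DiscreteTopology Letter := ⟨rfl⟩

/-- The free group on `a` and `b`. -/
abbrev F₂ : Type := FreeGroup Letter

/-- The element `s ^ m` of `F₂`. -/
def pow (s : Letter) (m : ℕ) : F₂ := FreeGroup.of s ^ m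

/-- `hung k a` is the set `S_{kab}`, and `hung k b` is the set `S_{kba}`:
`S_{0ab} = ∅` and
`S_{(k+1)ab} = S_{kab} ∪ a^{2^k} S_{kab} a^{-2^k} ∪ a^{2^k} ({b^{2^k}} ∪ S_{kba}) a^{-2^k}`,
and symmetrically with `a` and `b` exchanged. -/
def hung : ℕ → Letter → Set F₂
  | 0, _ => ∅
  | k + 1, s =>
      hung k s ∪
      (fun g => pow s (2 ^ k) * g * (pow s (2 ^ k))⁻¹) '' hung k s ∪
      (fun g => pow s (2 ^ k) * g * (pow s (2 ^ k))⁻¹) ''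
        ({pow s.other (2 ^ k)} ∪ hung k s.other)

/-- The subgroup `G_k = ⟨a^{2^k}, b^{2^k}, S_{kab}, S_{kba}⟩` of `F₂`. -/
def G (k : ℕ) : Subgroup F₂ :=
  Subgroup.closure
    ({pow .a (2 ^ k), pow .b (2 ^ k)} ∪ hung k .a ∪ hung k .b)

theorem pow_mem (k : ℕ) (s : Letter) : pow s (2 ^ k) ∈ G k :=
  Subgroup.subset_closure (by cases s <;> simp)

theorem hung_subset (k : ℕ) (s : Letter) : hung k s ⊆ G k := fun _ hx =>
  Subgroup.subset_closure (by cases s <;> simp [hx])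

theorem hung_succ_subset (k : ℕ) (s : Letter) : hung (k + 1) s ⊆ G k := by
  have hc : ∀ g ∈ G k, pow s (2 ^ k) * g * (pow s (2 ^ k))⁻¹ ∈ G k := fun g hg =>
    (G k).mul_mem ((G k).mul_mem (pow_mem k s) hg) ((G k).inv_mem (pow_mem k s))
  rintro x ((hx | ⟨g, hg, rfl⟩) | ⟨g, hg | hg, rfl⟩)
  · exact hung_subset k s hx
  · exact hc g (hung_subset k s hg)
  · exact hc g (by rw [mem_singleton_iff.1 hg]; exact pow_mem k _)
  · exact hc g (hung_subset k _ hg)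

theorem G_succ_le (k : ℕ) : G (k + 1) ≤ G k := by
  have hp : ∀ s, pow s (2 ^ (k + 1)) ∈ G k := fun s => by
    have h := (G k).pow_mem (pow_mem k s) 2
    rwa [pow, ← pow_mul, ← pow_succ] at h
  refine (Subgroup.closure_le _).2 ?_
  rintro x (((rfl | rfl) | hx) | hx)
  · exact hp .a
  · exact hp .b
  · exact hung_succ_subset k .a hx
  · exact hung_succ_subset k .b hx

/-- The vertices of the `k`-th graph: the cosets `G_k g`, `g ∈ F₂`. -/
def Vertex (k : ℕ) : Type := Quotient (QuotientGroup.rightRel (G k))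

instance (k : ℕ) : TopologicalSpace (Vertex k) := ⊥

instance (k : ℕ) : DiscreteTopology (Vertex k) := ⟨rfl⟩

/-- The coset `G_k g`. -/
def Vertex.mk (k : ℕ) (g : F₂) : Vertex k := Quotient.mk _ g

/-- The endpoint `G_k g s` of the `s`-edge that starts at `G_k g`. -/
def Vertex.step {k : ℕ} (s : Letter) : Vertex k → Vertex k :=
  Quotient.map (fun g => g * FreeGroup.of s) fun x y h => by
    have h' : y * x⁻¹ ∈ G k := QuotientGroup.rightRel_apply.1 h
    exact QuotientGroup.rightRel_apply.2 (by simpa [mul_assoc] using h')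

/-- The projection `G_{k+1} g ↦ G_k g`. -/
def Vertex.proj (k : ℕ) : Vertex (k + 1) → Vertex k :=
  Quotient.map id fun _ _ h =>
    QuotientGroup.rightRel_apply.2 (G_succ_le k (QuotientGroup.rightRel_apply.1 h))

theorem Vertex.proj_step (k : ℕ) (s : Letter) (w : Vertex (k + 1)) :
    Vertex.proj k (w.step s) = (Vertex.proj k w).step s := by
  induction w using Quotient.inductionOn
  rfl

/-- The gluing of the edges to the vertices: for every vertex `w` and letter `s` there is one edge
`{(w, s)} × [0, 1]`, which starts at `w` and ends at `w.step s`. -/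
inductive Glue (k : ℕ) :
    Vertex k ⊕ (Vertex k × Letter × unitInterval) →
      Vertex k ⊕ (Vertex k × Letter × unitInterval) → Prop
  | source (w : Vertex k) (s : Letter) : Glue k (Sum.inr (w, s, 0)) (Sum.inl w)
  | target (w : Vertex k) (s : Letter) : Glue k (Sum.inr (w, s, 1)) (Sum.inl (w.step s))

/-- The topological graph `Λ_k`: the Schreier diagram of `(F₂, G_k)` with respect to `a`, `b`. -/
def Graph (k : ℕ) : Type := Quot (Glue k)

instance (k : ℕ) : TopologicalSpace (Graph k) :=
  inferInstanceAs (TopologicalSpace (Quot (Glue k)))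

/-- A vertex, as a point of `Λ_k`. -/
def Graph.vertex {k : ℕ} (w : Vertex k) : Graph k := Quot.mk _ (Sum.inl w)

/-- The bonding map `Λ_{k+1} → Λ_k`, which maps edges to edges with the same label. -/
def bonding (k : ℕ) : Graph (k + 1) → Graph k :=
  Quot.map (Sum.map (Vertex.proj k) (Prod.map (Vertex.proj k) id)) fun _ _ h => by
    cases h with
    | source w s => exact Glue.source _ s
    | target w s =>
      have := Glue.target (Vertex.proj k w) s
      rwa [← Vertex.proj_step] at this

/-- The Schreier continuum `Λ`: the inverse limit of the spaces `Λ_k`. -/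
def Continuum : Type := {x : (k : ℕ) → Graph k // ∀ k, bonding k (x (k + 1)) = x k}

instance : TopologicalSpace Continuum :=
  inferInstanceAs
    (TopologicalSpace {x : (k : ℕ) → Graph k // ∀ k, bonding k (x (k + 1)) = x k})

/-- The vertices of `Λ` are the points all of whose coordinates are vertices. -/
def Continuum.IsVertex (v : Continuum) : Prop :=
  ∀ k, ∃ w : Vertex k, v.1 k = Graph.vertex w

/-- The vertex `s ^ m` of `Λ_k`, that is, the coset of `s ^ m`. -/
def cosetPow (k : ℕ) (s : Letter) (m : ℕ) : Graph k := Graph.vertex (Vertex.mk k (pow s m))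

/-- The vertex `id_k` of `Λ_k`. -/
def idVertex (k : ℕ) : Graph k := Graph.vertex (Vertex.mk k 1)

/-- The point `id = (id_k)` of `Λ`. -/
def idPoint : Continuum := ⟨idVertex, fun _ => rfl⟩

/-- For `k ≥ 1`, `arm k a` is `𝒜_k`, the path component of `Λ_k ∖ {id_k}` that contains
`a, a², ..., a^{2^k - 1}`, and `arm k b` is `ℬ_k`. -/
def arm (k : ℕ) (s : Letter) : Set (Graph k) :=
  pathComponentIn {idVertex k}ᶜ (cosetPow k s 1)

/-- `armPlus k a` is `𝒜⁺_{k+1}`, the path component of `𝒜_{k+1} ∖ {a^{2^k}}` that contains the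
`a^i` with `0 < i < 2^k`; `armPlus k b` is `ℬ⁺_{k+1}`. -/
def armPlus (k : ℕ) (s : Letter) : Set (Graph (k + 1)) :=
  pathComponentIn (arm (k + 1) s \ {cosetPow (k + 1) s (2 ^ k)}) (cosetPow (k + 1) s 1)

/-- `armMinus k a` is `𝒜⁻_{k+1}`, the path component of `𝒜_{k+1} ∖ {a^{2^k}}` that contains the
`a^i` with `2^k < i < 2^(k+1)`; `armMinus k b` is `ℬ⁻_{k+1}`. -/
def armMinus (k : ℕ) (s : Letter) : Set (Graph (k + 1)) :=
  pathComponentIn (arm (k + 1) s \ {cosetPow (k + 1) s (2 ^ k)})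
    (cosetPow (k + 1) s (2 ^ (k + 1) - 1))

/-- `armT k a` is `𝒯𝒜_{k+1}`, what remains of `𝒜_{k+1} ∖ {a^{2^k}}` (for `k ≥ 1` a single path
component) without `𝒜⁺_{k+1}` and `𝒜⁻_{k+1}`; `armT k b` is `𝒯ℬ_{k+1}`. -/
def armT (k : ℕ) (s : Letter) : Set (Graph (k + 1)) :=
  (arm (k + 1) s \ {cosetPow (k + 1) s (2 ^ k)}) \ (armPlus k s ∪ armMinus k s)

/-- The coordinates of `v` lie in `𝒯𝒜_k ∪ 𝒯ℬ_k` for at most finitely many `k`. -/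
def Continuum.IsDyadic (v : Continuum) : Prop :=
  {k : ℕ | v.1 (k + 1) ∈ armT k .a ∪ armT k .b}.Finite

/-- The path component `L_v` of `v` in `Λ`; it carries the leaf topology. -/
def Leaf (v : Continuum) : Type := {x : Continuum // x ∈ pathComponent v}

instance (v : Continuum) : TopologicalSpace (Leaf v) :=
  (leafTopology Continuum).induced Subtype.val

end Schori

namespace Schori

/-! The vertices of `Λ_k` are the words of length `k` in the digits `0`, `a`, `b`. The generator `s`
acts on words as an odometer: it adds `1` to the digits `0`, `s` read in binary, lowest digit first,
and the carry dies at the other letter. Under this action `G_k` is exactly the stabilizer of the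
word `0^k` (`G_eq_stab`), so a vertex of `Λ` is an infinite address, and edges join `u` to `odometer
s u`.

If the digits of `x` are not eventually constant, no carry or borrow runs forever in the class of
`x`, and the vertices of the leaf are the addresses that differ from `x` in finitely many digits
(`odometer_mem_cofinal`, `linked_cofinal`). An eventually constant address lies in the leaf of `id`
(`exists_ne_of_notMem`), so this covers every vertex outside that leaf.

If digit `k` is `s` and the nonzero digit preceding it is the other letter, the vertex lies in `armT
k s`: it hangs at `s^{2^k}`, off the line of powers of `s` (`vertex_mem_armT`). Hence a dyadic
vertex switches letters only finitely often, and from some digit on it uses only `0` and one letter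
`s` (`exists_eventually_ne_other`).

In such a leaf the addresses without the other letter form a single free `s`-orbit, a bi-infinite
line. Every vertex `u` hangs at the vertex `ground s u` of this line, inside a finite connected
piece (`linked_ground`, `finite_fiber`). The position of `ground s u` is a height that changes by at
most `1` along an edge (`height_step`). The parts of height in `[-n, n]` are compact, and what
remains is one connected unbounded piece above and one below, which gives two ends for every
exhaustion (`TwoEnded.card_ends`). -/

instance : DecidableEq Letter
  | .a, .a => isTrue rfl
  | .b, .b => isTrue rfl
  | .a, .b => isFalse (by simp)
  | .b, .a => isFalse (by simp)

instance : Finite Letter := Finite.of_injective (fun s : Letter => s = .a) (by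
  intro s t h
  cases s <;> cases t <;> simp_all)

theorem Letter.other_ne (s : Letter) : s.other ≠ s := by cases s <;> simp [Letter.other]

theorem Letter.other_other (s : Letter) : s.other.other = s := by cases s <;> rfl

theorem Letter.eq_or_eq_other (s t : Letter) : t = s ∨ t = s.other := by
  cases s <;> cases t <;> simp [Letter.other]

/-! ### Addresses of vertices -/

/-- Sequences of digits in `{0, a, b}`; the digit `0` is `none`. -/
abbrev Address : Type := ℕ → Option Letter

/-- The transposition of the digits `0` and `s`. -/
def flip (s : Letter) : Equiv.Perm (Option Letter) := Equiv.swap none (some s)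

@[simp] theorem flip_none (s : Letter) : flip s none = some s := Equiv.swap_apply_left _ _

@[simp] theorem flip_self (s : Letter) : flip s (some s) = none := Equiv.swap_apply_right _ _

@[simp] theorem flip_flip (s : Letter) (d : Option Letter) : flip s (flip s d) = d :=
  Equiv.swap_apply_self _ _ _

theorem flip_of_ne {s t : Letter} (h : t ≠ s) : flip s (some t) = some t :=
  Equiv.swap_apply_of_ne_of_ne (by simp) (by simpa using h)

theorem flip_eq_none {s : Letter} {d : Option Letter} : flip s d = none ↔ d = some s := by
  rw [← (flip s).apply_eq_iff_eq (x := d), flip_self]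

theorem flip_eq_self {s : Letter} {d : Option Letter} : flip s d = some s ↔ d = none := by
  rw [← (flip s).apply_eq_iff_eq (x := d), flip_none]

/-- Addition of `1` to the binary digits `0`, `s` of an address, starting with digit `k`. A carry
stops at a digit other than `0` and `s`. -/
def carry (k : ℕ) (s : Letter) (u : Address) : Address :=
  fun i => if k ≤ i ∧ ∀ j < i, k ≤ j → u j = some s then flip s (u i) else u i

/-- The inverse of `carry 0 s`. -/
def borrow (s : Letter) (u : Address) : Address :=
  fun i => if ∀ j < i, u j = none then flip s (u i) else u i

theorem carry_zero_apply (s : Letter) (u : Address) (i : ℕ) :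
    carry 0 s u i = if ∀ j < i, u j = some s then flip s (u i) else u i := by
  simp [carry]

theorem carry_eq_none_iff (s : Letter) (u : Address) (i : ℕ) :
    (∀ j < i, carry 0 s u j = none) ↔ ∀ j < i, u j = some s := by
  induction i with
  | zero => simp
  | succ i ih =>
    rw [Nat.forall_lt_succ_right, Nat.forall_lt_succ_right, ih]
    refine and_congr_right fun h => ?_
    rw [carry_zero_apply, if_pos h, flip_eq_none]

theorem borrow_eq_iff (s : Letter) (u : Address) (i : ℕ) :
    (∀ j < i, borrow s u j = some s) ↔ ∀ j < i, u j = none := by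
  induction i with
  | zero => simp
  | succ i ih =>
    rw [Nat.forall_lt_succ_right, Nat.forall_lt_succ_right, ih]
    refine and_congr_right fun h => ?_
    rw [borrow, if_pos h, flip_eq_self]

/-- The action of a generator on addresses. -/
def odometer (s : Letter) : Equiv.Perm Address where
  toFun := carry 0 s
  invFun := borrow s
  left_inv u := by
    funext i
    rw [borrow]
    simp only [carry_eq_none_iff]
    rw [carry_zero_apply]
    split_ifs <;> simp
  right_inv u := by
    funext i
    rw [carry_zero_apply]
    simp only [borrow_eq_iff]
    rw [borrow]
    split_ifs <;> simp

theorem odometer_apply (s : Letter) (u : Address) (i : ℕ) :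
    odometer s u i = if ∀ j < i, u j = some s then flip s (u i) else u i :=
  carry_zero_apply s u i

theorem odometer_symm_apply (s : Letter) (u : Address) (i : ℕ) :
    (odometer s).symm u i = if ∀ j < i, u j = none then flip s (u i) else u i := rfl

/-- Adding `2^k` twice adds `2^(k+1)`: digit `k` is flipped twice, and exactly one of the two flips
carries. If digit `k` were the other letter, both carries would die there while `carry (k + 1)` need
not be trivial; hence the hypothesis. -/
theorem carry_carry {k : ℕ} {s : Letter} {u : Address} (h : u k = none ∨ u k = some s) :
    carry k s (carry k s u) = carry (k + 1) s u := by
  have hk : carry k s u k = flip s (u k) := by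
    rw [carry, if_pos ⟨le_rfl, fun j h1 h2 => absurd h1 (by omega)⟩]
  funext i
  rcases lt_trichotomy i k with hi | rfl | hi
  · simp [carry, show ¬ k ≤ i by omega, show ¬ k + 1 ≤ i by omega]
  · rw [carry, if_pos ⟨le_rfl, fun j h1 h2 => absurd h1 (by omega)⟩, hk, flip_flip]
    simp [carry]
  · rcases h with h | h
    · have h1 : ∀ j, k < j → carry k s u j = u j := fun j hj => by
        rw [carry, if_neg]
        rintro ⟨-, h'⟩
        simpa [h] using h' k hj le_rfl
      change (if k ≤ i ∧ ∀ j < i, k ≤ j → carry k s u j = some s then flip s (carry k s u i)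
        else carry k s u i) = if k + 1 ≤ i ∧ ∀ j < i, k + 1 ≤ j → u j = some s then flip s (u i)
        else u i
      rw [h1 i hi]
      congr 1
      refine propext (and_congr (by omega) (forall₂_congr fun j hj => ?_))
      constructor
      · intro h' hkj
        rw [← h1 j hkj]
        exact h' (by omega)
      · intro h' hkj
        rcases hkj.eq_or_lt with rfl | hkj
        · rw [hk, h, flip_none]
        · rw [h1 j hkj]
          exact h' hkj
    · rw [carry, if_neg, carry, carry]
      · congr 1
        refine propext (and_congr (by omega) (forall₂_congr fun j hj => ?_))
        constructor
        · exact fun h' hkj => h' (by omega)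
        · intro h' hkj
          rcases hkj.eq_or_lt with rfl | hkj
          · exact h
          · exact h' hkj
      · rintro ⟨-, h'⟩
        have := h' k hi le_rfl
        rw [hk, h, flip_self] at this
        simp at this

theorem carry_apply_of_lt {k i : ℕ} (s : Letter) (u : Address) (h : i < k) :
    carry k s u i = u i := by
  simp [carry, show ¬ k ≤ i by omega]

theorem odometer_pow {k : ℕ} {s : Letter} {u : Address}
    (h : ∀ i < k, u i = none ∨ u i = some s) : (odometer s ^ 2 ^ k) u = carry k s u := by
  induction k generalizing u with
  | zero => rfl
  | succ k ih =>
    have h' : ∀ i < k, u i = none ∨ u i = some s := fun i hi => h i (by omega)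
    rw [pow_succ, pow_mul, pow_two, Equiv.Perm.mul_apply, ih h', ih, carry_carry (h k (by omega))]
    intro i hi
    rw [carry_apply_of_lt s u hi]
    exact h' i hi

theorem carry_of_none {k : ℕ} {s : Letter} {u : Address} (h : u k = none) :
    carry k s u = Function.update u k (some s) := by
  funext i
  rcases lt_trichotomy i k with hi | rfl | hi
  · rw [carry_apply_of_lt s u hi, Function.update_of_ne hi.ne]
  · rw [carry, if_pos ⟨le_rfl, fun j h1 h2 => absurd h1 (by omega)⟩, h]
    simp
  · rw [carry, if_neg, Function.update_of_ne hi.ne']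
    rintro ⟨-, h'⟩
    simpa [h] using h' k hi le_rfl

theorem carry_of_other {k : ℕ} {s : Letter} {u : Address} (h : u k = some s.other) :
    carry k s u = u := by
  funext i
  rcases lt_trichotomy i k with hi | rfl | hi
  · rw [carry_apply_of_lt s u hi]
  · rw [carry, if_pos ⟨le_rfl, fun j h1 h2 => absurd h1 (by omega)⟩, h, flip_of_ne s.other_ne]
  · rw [carry, if_neg]
    rintro ⟨-, h'⟩
    exact s.other_ne (by simpa [h] using h' k hi le_rfl)

/-! ### The action of the free group -/

/-- The right action of `F₂` on addresses, as a homomorphism. -/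
def actHom : F₂ →* (Equiv.Perm Address)ᵐᵒᵖ :=
  FreeGroup.lift fun s => MulOpposite.op (odometer s)

/-- The right action of `F₂` on addresses. -/
def act (u : Address) (g : F₂) : Address := (actHom g).unop u

@[simp] theorem act_one (u : Address) : act u 1 = u := by simp [act]

theorem act_mul (u : Address) (g h : F₂) : act u (g * h) = act (act u g) h := by simp [act]

theorem act_of (u : Address) (s : Letter) : act u (FreeGroup.of s) = odometer s u := by
  simp [act, actHom]

theorem act_pow (u : Address) (s : Letter) (m : ℕ) : act u (pow s m) = (odometer s ^ m) u := by
  simp [act, actHom, pow]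

@[simp] theorem act_mul_inv_cancel (u : Address) (g : F₂) : act (act u g) g⁻¹ = u := by
  rw [← act_mul, mul_inv_cancel, act_one]

@[simp] theorem act_inv_mul_cancel (u : Address) (g : F₂) : act (act u g⁻¹) g = u := by
  rw [← act_mul, inv_mul_cancel, act_one]

/-- Conjugation by `s^{2^k}` moves the test to the address with digit `k` equal to `s` and zeros
below. There `s.other^{2^k}` is blocked by digit `k`, and the remaining elements are covered by
induction, since only the first `k` digits have to vanish. All digits are fixed, not merely the
first `k`. -/
theorem act_hung {k : ℕ} {s : Letter} {g : F₂} (hg : g ∈ hung k s) {u : Address}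
    (hu : ∀ i < k, u i = none) : act u g = u := by
  induction k generalizing s g u with
  | zero => exact absurd hg (by simp [hung])
  | succ k ih =>
    have hu' : ∀ i < k, u i = none := fun i hi => hu i (by omega)
    have key : ∀ g, act (Function.update u k (some s)) g = Function.update u k (some s) →
        act u (pow s (2 ^ k) * g * (pow s (2 ^ k))⁻¹) = u := by
      intro g hg
      have h1 : act u (pow s (2 ^ k)) = Function.update u k (some s) := by
        rw [act_pow, odometer_pow fun i hi => Or.inl (hu' i hi), carry_of_none (hu k (by omega))]
      rw [act_mul, act_mul, h1, hg, ← h1, act_mul_inv_cancel]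
    have hv : ∀ i < k, Function.update u k (some s) i = none := fun i hi => by
      rw [Function.update_of_ne hi.ne, hu' i hi]
    rcases hg with (hg | ⟨g, hg, rfl⟩) | ⟨g, hg | hg, rfl⟩
    · exact ih hg hu'
    · exact key _ (ih hg hv)
    · refine key _ ?_
      rw [mem_singleton_iff.1 hg, act_pow, odometer_pow fun i hi => Or.inl (hv i hi),
        carry_of_other]
      simp [Letter.other_other]
    · exact key _ (ih hg hv)

/-- The address of the base point. -/
def zero : Address := fun _ => none

theorem act_apply_congr {k : ℕ} {u w : Address} (h : ∀ i < k, u i = w i) (g : F₂) :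
    ∀ i < k, act u g i = act w g i := by
  induction g using FreeGroup.induction_on generalizing u w with
  | C1 => simpa using h
  | of s =>
    intro i hi
    rw [act_of, act_of, odometer_apply, odometer_apply, h i hi]
    congr 1
    exact propext (forall₂_congr fun j hj => by rw [h j (by omega)])
  | inv_of s _ =>
    intro i hi
    have e : ∀ u, act u (FreeGroup.of s)⁻¹ = (odometer s).symm u := fun u => by
      rw [Equiv.eq_symm_apply, ← act_of, act_inv_mul_cancel]
    rw [e, e, odometer_symm_apply, odometer_symm_apply, h i hi]
    congr 1
    exact propext (forall₂_congr fun j hj => by rw [h j (by omega)])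
  | mul g g' h1 h2 =>
    rw [act_mul, act_mul]
    exact h2 (h1 h)

/-- The stabilizer of the first `k` digits of the base point. -/
def stab (k : ℕ) : Subgroup F₂ where
  carrier := {g | ∀ i < k, act zero g i = none}
  one_mem' := fun i _ => by simp [zero]
  mul_mem' {g h} hg hh i hi := by
    rw [act_mul, act_apply_congr (w := zero) hg h i hi]
    exact hh i hi
  inv_mem' {g} hg i hi := by
    rw [← act_apply_congr (u := act zero g) (w := zero) hg g⁻¹ i hi, act_mul_inv_cancel]
    rfl

theorem mem_stab {k : ℕ} {g : F₂} : g ∈ stab k ↔ ∀ i < k, act zero g i = none := Iff.rfl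

theorem act_zero_pow (k : ℕ) (s : Letter) :
    act zero (pow s (2 ^ k)) = Function.update zero k (some s) := by
  rw [act_pow, odometer_pow (u := zero) fun i _ => Or.inl rfl, carry_of_none rfl]

theorem G_le_stab (k : ℕ) : G k ≤ stab k := by
  refine (Subgroup.closure_le _).2 ?_
  have hp : ∀ s, pow s (2 ^ k) ∈ stab k := fun s i hi => by
    rw [act_zero_pow, Function.update_of_ne hi.ne]
    rfl
  have hh : ∀ s, ∀ g ∈ hung k s, g ∈ stab k := fun s g hg i _ => by
    rw [act_hung (u := zero) hg fun _ _ => rfl]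
    rfl
  rintro x (((rfl | rfl) | hx) | hx)
  exacts [hp _, hp _, hh _ _ hx, hh _ _ hx]

/-- The representatives of the cosets of `G (k + 1)` in `G k`. -/
def rep (k : ℕ) : Option Letter → F₂
  | none => 1
  | some s => pow s (2 ^ k)

/-- This bounds the index of `G (k + 1)` in `G k` by `3`: right multiplication by `g` permutes the
cosets of `1`, `a^{2^k}`, `b^{2^k}`. On generators, `s^{2^k}` swaps two of them and the elements of
the sets `hung` fix all three, which is what the recursion for `hung` provides. A permutation,
rather than a map, is needed for inverses. -/
theorem exists_perm_rep {k : ℕ} {g : F₂} (hg : g ∈ G k) :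
    ∃ τ : Equiv.Perm (Option Letter), ∀ d, rep k d * g * (rep k (τ d))⁻¹ ∈ G (k + 1) := by
  have hp : ∀ s : Letter, ∀ d,
      rep k d * pow s (2 ^ k) * (rep k (flip s d))⁻¹ ∈ G (k + 1) := by
    rintro s (_ | t)
    · simp [rep]
    · rcases s.eq_or_eq_other t with rfl | rfl
      · rw [flip_self]
        have h := pow_mem (k + 1) t
        rw [pow, pow_succ, mul_two, pow_add] at h
        simpa [rep, pow] using h
      · rw [flip_of_ne s.other_ne]
        exact hung_subset (k + 1) s.other
          (Or.inr ⟨_, Or.inl (by rw [s.other_other]; exact mem_singleton _), rfl⟩)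
  have hh : ∀ s, ∀ g ∈ hung k s, ∀ d, rep k d * g * (rep k (Equiv.refl _ d))⁻¹ ∈ G (k + 1) := by
    rintro s g hg (_ | t)
    · simpa [rep] using hung_subset (k + 1) s (Or.inl (Or.inl hg))
    · rcases s.eq_or_eq_other t with rfl | rfl
      · exact hung_subset (k + 1) t (Or.inl (Or.inr ⟨g, hg, rfl⟩))
      · exact hung_subset (k + 1) s.other
          (Or.inr ⟨g, Or.inr (by rwa [s.other_other]), rfl⟩)
  induction hg using Subgroup.closure_induction with
  | mem x hx =>
    rcases hx with ((rfl | rfl) | hx) | hx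
    exacts [⟨_, hp _⟩, ⟨_, hp _⟩, ⟨_, hh _ _ hx⟩, ⟨_, hh _ _ hx⟩]
  | one => exact ⟨Equiv.refl _, fun d => by simp⟩
  | mul x y _ _ hx hy =>
    obtain ⟨τ, hτ⟩ := hx
    obtain ⟨υ, hυ⟩ := hy
    exact ⟨τ.trans υ, fun d => by simpa [mul_assoc] using mul_mem (hτ d) (hυ (τ d))⟩
  | inv x _ hx =>
    obtain ⟨τ, hτ⟩ := hx
    exact ⟨τ.symm, fun d => by simpa [mul_assoc] using inv_mem (hτ (τ.symm d))⟩

/-- An element `g` of the smaller stabilizer lies in `G k` by induction, so it is an element of `G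
(k + 1)` times a representative. The representative also stabilizes `0^{k+1}`, and `s^{2^k}` does
not, so it is `1`. -/
theorem G_eq_stab (k : ℕ) : G k = stab k := by
  refine le_antisymm (G_le_stab k) ?_
  induction k with
  | zero =>
    have h : ∀ g, g ∈ G 0 := fun g => by
      induction g using FreeGroup.induction_on with
      | C1 => exact one_mem _
      | of s => simpa [pow] using pow_mem 0 s
      | inv_of s h => exact inv_mem h
      | mul g h hg hh => exact mul_mem hg hh
    exact fun g _ => h g
  | succ k ih =>
    intro g hg
    obtain ⟨τ, hτ⟩ := exists_perm_rep (ih fun i hi => hg i (by omega))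
    have h1 := hτ none
    have h2 : rep k (τ none) ∈ stab (k + 1) := by
      have h := mul_mem (inv_mem (G_le_stab _ h1)) hg
      simpa [rep] using h
    cases hd : τ none with
    | none => simpa [hd, rep] using h1
    | some s =>
      have h := h2 k (by omega)
      simp [hd, rep, act_zero_pow] at h

/-! ### Linked addresses -/

/-- Two addresses are linked in `S` if they are joined by a chain of edges with endpoints in `S`. -/
inductive Linked (S : Set Address) : Address → Address → Prop
  | refl {u : Address} (hu : u ∈ S) : Linked S u u
  | edge {u : Address} (s : Letter) (hu : u ∈ S) (hs : odometer s u ∈ S) :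
      Linked S u (odometer s u)
  | symm {u w : Address} (h : Linked S u w) : Linked S w u
  | trans {u v w : Address} (h₁ : Linked S u v) (h₂ : Linked S v w) : Linked S u w

theorem Linked.mono {S T : Set Address} (h : S ⊆ T) {u w : Address} (hl : Linked S u w) :
    Linked T u w := by
  induction hl with
  | refl hu => exact .refl (h hu)
  | edge s hu hs => exact .edge s (h hu) (h hs)
  | symm _ ih => exact ih.symm
  | trans _ _ ih1 ih2 => exact ih1.trans ih2

/-- The address `u` with the first `n` digits replaced by `0`. -/
def erase (n : ℕ) (u : Address) : Address := fun i => if i < n then none else u i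

/-- The address `s^n 0 u_{n+1} u_{n+2} ...` -/
def fill (n : ℕ) (s : Letter) (u : Address) : Address :=
  fun i => if i < n then some s else if i = n then none else u i

theorem odometer_fill {n : ℕ} {s : Letter} {u : Address} (h : u n = some s) :
    odometer s (fill n s u) = erase n u := by
  funext i
  rw [odometer_apply]
  rcases lt_trichotomy i n with hi | rfl | hi
  · rw [if_pos fun j hj => by simp [fill, show j < n by omega]]
    simp [fill, erase, hi]
  · rw [if_pos fun j hj => by simp [fill, hj]]
    simp [fill, erase, h]
  · rw [if_neg fun h' => by simpa [fill] using h' n hi]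
    simp [fill, erase, hi.not_gt, hi.ne']

theorem erase_fill (n : ℕ) (s : Letter) (u : Address) :
    erase n (fill n s u) = erase (n + 1) u := by
  funext i
  simp only [erase, fill]
  split_ifs <;> first | rfl | omega

theorem erase_succ_of_none {n : ℕ} {u : Address} (h : u n = none) :
    erase (n + 1) u = erase n u := by
  funext i
  simp only [erase]
  split_ifs with h1 h2 h2
  · rfl
  · rw [show i = n by omega, h]
  · omega
  · rfl

/-- The addresses with the same digits as `u` from the `n`-th on. -/
def tailSet (n : ℕ) (u : Address) : Set Address := {w | ∀ i, n ≤ i → w i = u i}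

theorem tailSet_subset {m n : ℕ} (h : m ≤ n) {u w : Address} (hu : u ∈ tailSet n w) :
    tailSet m u ⊆ tailSet n w := by
  intro x hx i hi
  rw [hx i (h.trans hi), hu i hi]

theorem mem_tailSet_self (n : ℕ) (u : Address) : u ∈ tailSet n u := fun _ _ => rfl

/-- To clear a digit `s` in position `n`, clear the digits below it, step back along the `s`-edge
from `0^n s ...` to `s^n 0 ...`, and clear the lower digits again. Digits from `n + 1` on never
change. -/
theorem linked_erase (n : ℕ) (u : Address) : Linked (tailSet n u) u (erase n u) := by
  induction n generalizing u with
  | zero =>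
    have : erase 0 u = u := by funext i; simp [erase]
    rw [this]
    exact .refl fun _ _ => rfl
  | succ n ih =>
    have h1 : Linked (tailSet (n + 1) u) u (erase n u) :=
      (ih u).mono (tailSet_subset n.le_succ (mem_tailSet_self _ _))
    cases hd : u n with
    | none => rwa [erase_succ_of_none hd]
    | some s =>
      have hf : fill n s u ∈ tailSet (n + 1) u := fun i hi => by
        simp [fill, show ¬ i < n by omega, show i ≠ n by omega]
      have he : erase n u ∈ tailSet (n + 1) u := fun i hi => by
        simp [erase, show ¬ i < n by omega]
      have h2 : Linked (tailSet (n + 1) u) (fill n s u) (erase n u) := by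
        have := Linked.edge s hf (by rwa [odometer_fill hd])
        rwa [odometer_fill hd] at this
      have h3 := (ih (fill n s u)).mono (tailSet_subset n.le_succ hf)
      rw [erase_fill] at h3
      exact h1.trans (h2.symm.trans h3)

/-! ### Vertices and addresses -/

theorem mk_eq_mk {k : ℕ} {g h : F₂} :
    Vertex.mk k g = Vertex.mk k h ↔ ∀ i < k, act zero g i = act zero h i := by
  have e : Vertex.mk k g = Vertex.mk k h ↔ h * g⁻¹ ∈ G k :=
    Quotient.eq.trans QuotientGroup.rightRel_apply
  rw [e, G_eq_stab, mem_stab]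
  constructor
  · intro H i hi
    have := act_apply_congr (u := act zero (h * g⁻¹)) (w := zero) H g i hi
    rw [← this, ← act_mul, inv_mul_cancel_right]
  · intro H i hi
    rw [act_mul, ← act_apply_congr H g⁻¹ i hi, act_mul_inv_cancel]
    rfl

theorem Linked.exists_act {S : Set Address} {u w : Address} (h : Linked S u w) :
    ∃ g, act u g = w := by
  induction h with
  | refl => exact ⟨1, act_one _⟩
  | edge s => exact ⟨_, act_of _ s⟩
  | symm _ ih =>
    obtain ⟨g, rfl⟩ := ih
    exact ⟨g⁻¹, act_mul_inv_cancel _ _⟩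
  | trans _ _ ih1 ih2 =>
    obtain ⟨g, rfl⟩ := ih1
    obtain ⟨h, rfl⟩ := ih2
    exact ⟨g * h, act_mul _ _ _⟩

theorem exists_act_zero (k : ℕ) (u : Address) : ∃ g, ∀ i < k, act zero g i = u i := by
  obtain ⟨g, hg⟩ := (linked_erase k fun i => if i < k then u i else none).symm.exists_act
  refine ⟨g, fun i hi => ?_⟩
  have h0 : ∀ i < k, erase k (fun i => if i < k then u i else none) i = zero i := fun i hi => by
    simp [erase, hi, zero]
  rw [← act_apply_congr h0 g i hi, hg]
  simp [hi]

/-- The vertex of `Λ_k` that is given by the first `k` digits of an address. -/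
noncomputable def toVertex (k : ℕ) (u : Address) : Vertex k :=
  Vertex.mk k (exists_act_zero k u).choose

theorem toVertex_eq_mk {k : ℕ} {u : Address} {g : F₂} :
    toVertex k u = Vertex.mk k g ↔ ∀ i < k, u i = act zero g i := by
  rw [toVertex, mk_eq_mk]
  exact forall₂_congr fun i hi => by rw [(exists_act_zero k u).choose_spec i hi]

theorem exists_toVertex {k : ℕ} (w : Vertex k) : ∃ u, toVertex k u = w := by
  induction w using Quotient.inductionOn with
  | h g => exact ⟨act zero g, toVertex_eq_mk.2 fun _ _ => rfl⟩

theorem toVertex_eq_iff {k : ℕ} {u w : Address} :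
    toVertex k u = toVertex k w ↔ ∀ i < k, u i = w i := by
  obtain ⟨g, hg⟩ := exists_act_zero k w
  rw [toVertex_eq_mk.2 fun i hi => (hg i hi).symm, toVertex_eq_mk]
  exact forall₂_congr fun i hi => by rw [hg i hi]

theorem toVertex_odometer (k : ℕ) (s : Letter) (u : Address) :
    toVertex k (odometer s u) = (toVertex k u).step s := by
  obtain ⟨g, hg⟩ := exists_act_zero k u
  rw [toVertex_eq_mk.2 fun i hi => (hg i hi).symm]
  refine toVertex_eq_mk.2 fun i hi => ?_
  rw [act_mul, ← act_of]
  exact (act_apply_congr hg _ i hi).symm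

theorem proj_toVertex (k : ℕ) (u : Address) :
    Vertex.proj k (toVertex (k + 1) u) = toVertex k u := by
  obtain ⟨g, hg⟩ := exists_act_zero (k + 1) u
  rw [toVertex_eq_mk.2 fun i hi => (hg i hi).symm]
  exact (toVertex_eq_mk.2 fun i hi => (hg i (by omega)).symm).symm

theorem exists_address (w : ∀ k, Vertex k) (hw : ∀ k, Vertex.proj k (w (k + 1)) = w k) :
    ∃ u, ∀ k, toVertex k u = w k := by
  choose f hf using fun k => exists_toVertex (w k)
  have h : ∀ k, ∀ i < k, f (k + 1) i = f k i := fun k => by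
    rw [← toVertex_eq_iff, hf, ← proj_toVertex, hf, hw]
  -- Diagonal choice: digit `i` is the same at all levels from `i + 1` on.
  refine ⟨fun i => f (i + 1) i, fun k => ?_⟩
  rw [← hf k, toVertex_eq_iff]
  induction k with
  | zero => intro i hi; omega
  | succ k ih =>
    intro i hi
    rcases (Nat.lt_succ_iff.1 hi).eq_or_lt with rfl | hi'
    · rfl
    · rw [h k i hi', ih i hi']

end Schori

/-! ## A criterion for having two ends -/

namespace SpaceEnds

/-- An increasing sequence of compact sets whose interiors cover the space, such that the
complement of each of them is the union of two disjoint unbounded connected open sets. -/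
structure TwoEnded {X : Type*} [TopologicalSpace X] (C P M : ℕ → Set X) : Prop where
  isCompact : ∀ n, IsCompact (C n)
  mono : Monotone C
  exists_mem_nhds : ∀ x, ∃ n, C n ∈ 𝓝 x
  compl_eq : ∀ n, (C n)ᶜ = P n ∪ M n
  isOpen_pos : ∀ n, IsOpen (P n)
  isOpen_neg : ∀ n, IsOpen (M n)
  disj : ∀ n, Disjoint (P n) (M n)
  anti_pos : Antitone P
  anti_neg : Antitone M
  conn_pos : ∀ n, IsConnected (P n)
  conn_neg : ∀ n, IsConnected (M n)

namespace TwoEnded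

variable {X : Type*} [TopologicalSpace X] {C P M : ℕ → Set X}

theorem swap (h : TwoEnded C P M) : TwoEnded C M P where
  isCompact := h.isCompact
  mono := h.mono
  exists_mem_nhds := h.exists_mem_nhds
  compl_eq n := by rw [h.compl_eq, union_comm]
  isOpen_pos := h.isOpen_neg
  isOpen_neg := h.isOpen_pos
  disj n := (h.disj n).symm
  anti_pos := h.anti_neg
  anti_neg := h.anti_pos
  conn_pos := h.conn_neg
  conn_neg := h.conn_pos

theorem exists_superset (h : TwoEnded C P M) {K : Set X} (hK : IsCompact K) : ∃ n, K ⊆ C n := by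
  suffices ∃ n, K ⊆ interior (C n) from this.imp fun _ hn => hn.trans interior_subset
  refine hK.elim_directed_cover (interior ∘ C) (fun _ => isOpen_interior) ?_ ?_
  · intro x _
    obtain ⟨n, hn⟩ := h.exists_mem_nhds x
    exact mem_iUnion.2 ⟨n, mem_interior_iff_mem_nhds.2 hn⟩
  · exact Monotone.directed_le fun _ _ hmn => interior_mono (h.mono hmn)

theorem nonempty_exhaustion (h : TwoEnded C P M) : Nonempty (CompactExhaustion X) := by
  have : WeaklyLocallyCompactSpace X :=
    ⟨fun x => (h.exists_mem_nhds x).elim fun n hn => ⟨C n, h.isCompact n, hn⟩⟩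
  have : SigmaCompactSpace X := ⟨⟨C, h.isCompact, eq_univ_of_forall fun x =>
    mem_iUnion.2 ((h.exists_mem_nhds x).imp fun n hn => mem_of_mem_nhds hn)⟩⟩
  exact ⟨CompactExhaustion.choice X⟩

variable (K : CompactExhaustion X)

/-- The index of a member of the sequence `C` that contains `K i`. -/
noncomputable def index (h : TwoEnded C P M) (i : ℕ) : ℕ :=
  (h.exists_superset (K.isCompact i)).choose

theorem subset_index (h : TwoEnded C P M) (i : ℕ) : K i ⊆ C (h.index K i) :=
  (h.exists_superset (K.isCompact i)).choose_spec

theorem pos_subset_compl (h : TwoEnded C P M) {n i : ℕ} (hK : K i ⊆ C n) : P n ⊆ (K i)ᶜ :=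
  fun _ hx hx' => (h.compl_eq n).superset (Or.inl hx) (hK hx')

/-- The component of the complement of `K i` that contains almost all of the sets `P n`. -/
noncomputable def side (h : TwoEnded C P M) (i : ℕ) : Set X :=
  connectedComponentIn (K i)ᶜ (h.conn_pos (h.index K i)).nonempty.some

/-- Any two of the connected sets `P m`, `P n` share the nonempty set `P (max m n)`, so the
component does not depend on the chosen index or point. -/
theorem side_eq (h : TwoEnded C P M) {i n : ℕ} {x : X} (hK : K i ⊆ C n) (hx : x ∈ P n) :
    h.side K i = connectedComponentIn (K i)ᶜ x := by
  set m := h.index K i with hm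
  have hm' : K i ⊆ C m := h.subset_index K i
  have hp := (h.conn_pos m).nonempty.some_mem
  set p := (h.conn_pos m).nonempty.some
  obtain ⟨q, hq⟩ := (h.conn_pos (max m n)).nonempty
  have h1 : q ∈ connectedComponentIn (K i)ᶜ p :=
    (h.conn_pos m).isPreconnected.subset_connectedComponentIn hp (h.pos_subset_compl K hm')
      (h.anti_pos (le_max_left m n) hq)
  have h2 : q ∈ connectedComponentIn (K i)ᶜ x :=
    (h.conn_pos n).isPreconnected.subset_connectedComponentIn hx (h.pos_subset_compl K hK)
      (h.anti_pos (le_max_right m n) hq)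
  change connectedComponentIn (K i)ᶜ p = _
  rw [connectedComponentIn_eq h1, connectedComponentIn_eq h2]

theorem pos_subset_side (h : TwoEnded C P M) {i n : ℕ} (hK : K i ⊆ C n) : P n ⊆ h.side K i := by
  intro x hx
  rw [h.side_eq K hK hx]
  exact mem_connectedComponentIn (h.pos_subset_compl K hK hx)

theorem component_eq_side (h : TwoEnded C P M) {U : Set X} {i n : ℕ} (hK : K i ⊆ C n)
    (hU : ∃ x ∈ (K i)ᶜ, U = connectedComponentIn (K i)ᶜ x) (hn : (U ∩ P n).Nonempty) :
    U = h.side K i := by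
  obtain ⟨x, -, rfl⟩ := hU
  obtain ⟨y, hy, hy'⟩ := hn
  rw [h.side_eq K hK hy', connectedComponentIn_eq hy]

theorem not_subset_compact (h : TwoEnded C P M) (n : ℕ) {D : Set X} (hD : IsCompact D) :
    ¬ P n ⊆ D := by
  intro hs
  obtain ⟨m, hm⟩ := h.exists_superset hD
  obtain ⟨x, hx⟩ := (h.conn_pos (max m n)).nonempty
  have h1 : x ∈ (C m)ᶜ :=
    (h.compl_eq m).superset (Or.inl (h.anti_pos (le_max_left m n) hx))
  exact h1 (hm (hs (h.anti_pos (le_max_right m n) hx)))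

theorem side_anti (h : TwoEnded C P M) (i : ℕ) : h.side K (i + 1) ⊆ h.side K i := by
  have hK := h.subset_index K (i + 1)
  obtain ⟨x, hx⟩ := (h.conn_pos (h.index K (i + 1))).nonempty
  rw [h.side_eq K hK hx, h.side_eq K ((K.subset_succ i).trans hK) hx]
  exact connectedComponentIn_mono x (compl_subset_compl.2 (K.subset_succ i))

theorem iInter_eq_empty_of_subset {U : ℕ → Set X} (hU : ∀ i, U i ⊆ (K i)ᶜ) : ⋂ i, U i = ∅ := by
  refine eq_empty_of_forall_notMem fun x hx => ?_
  obtain ⟨n, hn⟩ := K.exists_mem x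
  exact hU n (mem_iInter.1 hx n) hn

/-- The chain of the components that contain almost all of the sets `P n`. -/
noncomputable def chain (h : TwoEnded C P M) : Chain K where
  U := h.side K
  isComponent i := ⟨_, h.pos_subset_compl K (h.subset_index K i)
    (h.conn_pos (h.index K i)).nonempty.some_mem, rfl⟩
  unbounded i := fun ⟨_, hD, hs⟩ =>
    h.not_subset_compact _ hD ((h.pos_subset_side K (h.subset_index K i)).trans hs)
  anti := h.side_anti K
  iInter_eq_empty := iInter_eq_empty_of_subset K fun _ => connectedComponentIn_subset _ _

/-- An unbounded component leaves the compact set `C n`, so it meets `P n` or `M n`, each of which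
lies in a single component. -/
theorem component_eq_or (h : TwoEnded C P M) (c : Chain K) (i : ℕ) :
    c.U i = h.side K i ∨ c.U i = h.swap.side K i := by
  set n := h.index K i
  have hK := h.subset_index K i
  have : ¬ c.U i ⊆ C n := fun hs => c.unbounded i ⟨_, h.isCompact n, hs⟩
  obtain ⟨x, hx, hx'⟩ := not_subset.1 this
  rcases (h.compl_eq n).subset hx' with hp | hp
  · exact Or.inl (h.component_eq_side K hK (c.isComponent i) ⟨x, hx, hp⟩)
  · exact Or.inr (h.swap.component_eq_side K hK (c.isComponent i) ⟨x, hx, hp⟩)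

/-- Once `K j` contains `C 0`, its complement lies in the disjoint open sets `P 0` and `M 0`, and
the two sides stay in different ones. -/
theorem exists_disjoint (h : TwoEnded C P M) :
    ∃ i, ∀ j ≥ i, Disjoint (h.side K j) (h.swap.side K j) := by
  obtain ⟨i, hi⟩ := K.exists_superset_of_isCompact (h.isCompact 0)
  refine ⟨i, fun j hj => ?_⟩
  have key : ∀ {P M : ℕ → Set X} (h : TwoEnded C P M), h.side K j ⊆ P 0 := by
    intro P M h
    have hs : h.side K j ⊆ P 0 ∪ M 0 := by
      rw [← h.compl_eq]
      exact (connectedComponentIn_subset _ _).trans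
        (compl_subset_compl.2 (hi.trans (K.subset hj)))
    refine IsPreconnected.subset_left_of_subset_union (h.isOpen_pos 0) (h.isOpen_neg 0) (h.disj 0)
      hs ?_ isPreconnected_connectedComponentIn
    obtain ⟨x, hx⟩ := (h.conn_pos (h.index K j)).nonempty
    exact ⟨x, h.pos_subset_side K (h.subset_index K j) hx, h.anti_pos (Nat.zero_le _) hx⟩
  exact (h.disj 0).mono (key h) (key h.swap)

/-- Past the index where the sides become disjoint, nestedness forbids a chain to change sides. At
earlier indices its member contains a later one, hence meets some `P n` and is the same side. -/
theorem chain_eq_or (h : TwoEnded C P M) (c : Chain K) :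
    c.U = h.side K ∨ c.U = h.swap.side K := by
  obtain ⟨i, hi⟩ := h.exists_disjoint K
  have key : ∀ {P M : ℕ → Set X} (h : TwoEnded C P M),
      (∀ j ≥ i, Disjoint (h.side K j) (h.swap.side K j)) → c.U i = h.side K i →
        c.U = h.side K := by
    intro P M h hi hc
    have hge : ∀ j ≥ i, c.U j = h.side K j := by
      intro j hj
      refine (h.component_eq_or K c j).resolve_right fun hj' => ?_
      obtain ⟨x, hx⟩ := (h.conn_neg (h.index K j)).nonempty
      have hx1 : x ∈ h.swap.side K j := h.swap.pos_subset_side K (h.subset_index K j) hx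
      have hx2 : x ∈ h.side K i := hc ▸ c.antitone hj (hj' ▸ hx1)
      have hx3 : x ∈ h.swap.side K i := (h.swap.chain K).antitone hj hx1
      exact (hi i le_rfl).le_bot ⟨hx2, hx3⟩
    funext j
    rcases le_total i j with hj | hj
    · exact hge j hj
    · set n := h.index K (max i j)
      have hK := h.subset_index K (max i j)
      obtain ⟨x, hx⟩ := (h.conn_pos n).nonempty
      have hx1 : x ∈ c.U i := hc ▸ h.pos_subset_side K ((K.subset (le_max_left i j)).trans hK) hx
      exact h.component_eq_side K ((K.subset (le_max_right i j)).trans hK) (c.isComponent j)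
        ⟨x, c.antitone hj hx1, hx⟩
  rcases h.component_eq_or K c i with hc | hc
  · exact Or.inl (key h hi hc)
  · exact Or.inr (key h.swap (fun j hj => (hi j hj).symm) hc)

theorem card_ends (h : TwoEnded C P M) : Nat.card (Ends K) = 2 := by
  let f : Fin 2 → Ends K := fun n =>
    if n = 0 then Quotient.mk _ (h.chain K) else Quotient.mk _ (h.swap.chain K)
  have hne : (Quotient.mk (chainSetoid K) (h.chain K)) ≠ Quotient.mk _ (h.swap.chain K) := by
    intro he
    obtain ⟨i, hi⟩ := h.exists_disjoint K
    obtain ⟨j, hj, hs⟩ := Quotient.exact he i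
    obtain ⟨x, hx⟩ := (h.conn_pos (h.index K j)).nonempty
    exact (hi i le_rfl).le_bot (hs (Or.inl (h.pos_subset_side K (h.subset_index K j) hx)))
  have hf : Function.Bijective f := by
    constructor
    · intro m n hmn
      fin_cases m <;> fin_cases n <;> simp_all [f]
    · intro e
      induction e using Quotient.inductionOn with
      | h c =>
        have hc : ∀ d : Chain K, c.U = d.U → Quotient.mk (chainSetoid K) d = Quotient.mk _ c := by
          intro d hd
          refine Quotient.sound fun i => ⟨i + 1, Nat.lt_succ_self i, ?_⟩
          rw [hd, union_self, inter_self]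
          exact d.anti i
        rcases h.chain_eq_or K c with h' | h'
        · exact ⟨0, hc (h.chain K) h'⟩
        · exact ⟨1, hc (h.swap.chain K) h'⟩
  rw [← Nat.card_eq_of_bijective f hf, Nat.card_fin]

end TwoEnded

end SpaceEnds

instance : LocallyPathConnectedSpace unitInterval :=
  (convex_Icc (0 : ℝ) 1).locallyPathConnectedSpace

/-! ## Paths and the leaf topology -/

theorem joinedIn_image_unitInterval {X : Type*} [TopologicalSpace X] {f : unitInterval → X}
    (hf : Continuous f) {S : Set X} {a b : unitInterval} (h : ∀ c ∈ uIcc a b, f c ∈ S) :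
    JoinedIn S (f a) (f b) := by
  have hc : JoinedIn (uIcc a b) a b := by
    have h1 : JoinedIn (uIcc (a : ℝ) b) a b :=
      ((convex_uIcc (a : ℝ) b).isPathConnected nonempty_uIcc).joinedIn _ left_mem_uIcc _
        right_mem_uIcc
    -- The segment is convex in `ℝ`; `projIcc` brings the path back to the unit interval.
    have h2 := h1.map (continuous_projIcc (h := zero_le_one' ℝ))
    rw [projIcc_val, projIcc_val] at h2
    refine h2.mono ?_
    rintro _ ⟨t, ht, rfl⟩
    have hm := monotone_projIcc (zero_le_one' ℝ)
    rcases le_total a b with hab | hab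
    · rw [uIcc_of_le (by exact_mod_cast hab)] at ht
      rw [uIcc_of_le hab, ← projIcc_val (zero_le_one' ℝ) a, ← projIcc_val (zero_le_one' ℝ) b]
      exact ⟨hm ht.1, hm ht.2⟩
    · rw [uIcc_of_ge (by exact_mod_cast hab)] at ht
      rw [uIcc_of_ge hab, ← projIcc_val (zero_le_one' ℝ) a, ← projIcc_val (zero_le_one' ℝ) b]
      exact ⟨hm ht.1, hm ht.2⟩
  exact (hc.map_continuousOn hf.continuousOn).mono (image_subset_iff.2 h)

/-- Near `y`, the path component of `y` in `f ⁻¹' U` is open and is mapped into one path component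
of `U`. In particular paths in `Λ` are also paths for the leaf topology. -/
theorem Continuous.leafTopology {X Y : Type*} [TopologicalSpace X] [TopologicalSpace Y]
    [LocallyPathConnectedSpace Y] {f : Y → X} (hf : Continuous f) :
    @Continuous Y X _ (leafTopology X) f := by
  refine continuous_generateFrom_iff.2 ?_
  rintro _ ⟨U, hU, x, hx, rfl⟩
  refine isOpen_iff_mem_nhds.2 fun y hy => ?_
  have hyU : f y ∈ U := pathComponentIn_subset hy
  refine Filter.mem_of_superset (((hU.preimage hf).pathComponentIn y).mem_nhds
    (mem_pathComponentIn_self hyU)) fun z hz => ?_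
  exact JoinedIn.trans hy ((hz.map_continuousOn hf.continuousOn).mono (image_preimage_subset f U))

theorem isOpen_leafTopology_pathComponentIn {X : Type*} [TopologicalSpace X] {U : Set X}
    (hU : IsOpen U) {x : X} (hx : x ∈ U) : IsOpen[leafTopology X] (pathComponentIn U x) :=
  TopologicalSpace.isOpen_generateFrom_of_mem ⟨U, hU, x, hx, rfl⟩

theorem isOpen_leafTopology_of_forall {X : Type*} [TopologicalSpace X] {S : Set X}
    (h : ∀ x ∈ S, ∃ U, IsOpen U ∧ x ∈ U ∧ pathComponentIn U x ⊆ S) :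
    IsOpen[leafTopology X] S := by
  choose! U hU hx hs using h
  have : S = ⋃ x ∈ S, pathComponentIn (U x) x :=
    Subset.antisymm (fun x hxS => mem_iUnion₂.2 ⟨x, hxS, mem_pathComponentIn_self (hx x hxS)⟩)
      (iUnion₂_subset hs)
  rw [this]
  exact @isOpen_biUnion _ _ (leafTopology X) _ _ fun x hxS =>
    isOpen_leafTopology_pathComponentIn (hU x hxS) (hx x hxS)

/-- A path component is connected, so its image cannot pass between members of a disjoint open
family. -/
theorem pathComponentIn_subset_preimage {X Y ι : Type*} [TopologicalSpace X] [TopologicalSpace Y]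
    {f : X → Y} (hf : Continuous f) {U : Set X} {N : ι → Set Y} (hN : ∀ i, IsOpen (N i))
    (hd : ∀ i j, ((N i) ∩ (N j)).Nonempty → i = j) (hU : ∀ x ∈ U, ∃ i, f x ∈ N i) {x : X} {i : ι}
    (hx : f x ∈ N i) : pathComponentIn U x ⊆ f ⁻¹' N i := by
  by_cases hxU : x ∈ U
  · refine IsPreconnected.subset_left_of_subset_union ((hN i).preimage hf)
      ((isOpen_biUnion fun j (_ : j ≠ i) => hN j).preimage hf) ?_ ?_
      ⟨x, mem_pathComponentIn_self hxU, hx⟩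
      (isPathConnected_pathComponentIn hxU).isConnected.isPreconnected
    · refine disjoint_left.2 fun y hy hy' => ?_
      obtain ⟨j, hj, hy'⟩ := mem_iUnion₂.1 hy'
      exact hj (hd j i ⟨_, hy', hy⟩)
    · intro y hy
      obtain ⟨j, hj⟩ := hU y (pathComponentIn_subset hy)
      by_cases h : j = i
      · exact Or.inl (h ▸ hj)
      · exact Or.inr (mem_iUnion₂.2 ⟨j, h, hj⟩)
  · intro y hy
    exact absurd (JoinedIn.source_mem hy) hxU

namespace Schori

/-! ### The graphs `Λ_k` -/

namespace Graph

variable {k : ℕ}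

/-- The point with parameter `t` of the `s`-edge that starts at `w`. -/
def edge (w : Vertex k) (s : Letter) (t : unitInterval) : Graph k := Quot.mk _ (Sum.inr (w, s, t))

@[simp] theorem edge_zero (w : Vertex k) (s : Letter) : edge w s 0 = vertex w :=
  Quot.sound (Glue.source w s)

@[simp] theorem edge_one (w : Vertex k) (s : Letter) : edge w s 1 = vertex (w.step s) :=
  Quot.sound (Glue.target w s)

theorem exists_eq_edge (x : Graph k) : ∃ w s t, x = edge w s t := by
  induction x using Quot.ind with
  | mk x =>
    rcases x with w | ⟨w, s, t⟩
    · exact ⟨w, .a, 0, (edge_zero w _).symm⟩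
    · exact ⟨w, s, t, rfl⟩

theorem bonding_edge (w : Vertex (k + 1)) (s : Letter) (t : unitInterval) :
    bonding k (edge w s t) = edge (Vertex.proj k w) s t := rfl

theorem bonding_vertex (w : Vertex (k + 1)) :
    bonding k (vertex w) = vertex (Vertex.proj k w) := rfl

theorem continuous_edge (w : Vertex k) (s : Letter) : Continuous (edge w s) :=
  continuous_quot_mk.comp (continuous_inr.comp (by fun_prop))

open scoped Classical in
/-- A representative of a point, which is a vertex or an interior point of an edge. -/
noncomputable def normalForm : Graph k → Vertex k ⊕ (Vertex k × Letter × unitInterval) :=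
  Quot.lift
    (Sum.elim Sum.inl fun e =>
      if e.2.2 = 0 then Sum.inl e.1 else if e.2.2 = 1 then Sum.inl (e.1.step e.2.1)
      else Sum.inr e)
    (by rintro _ _ (⟨w, s⟩ | ⟨w, s⟩) <;> simp)

theorem normalForm_vertex (w : Vertex k) : normalForm (vertex w) = Sum.inl w := rfl

theorem normalForm_edge (w : Vertex k) (s : Letter) {t : unitInterval} (h0 : t ≠ 0) (h1 : t ≠ 1) :
    normalForm (edge w s t) = Sum.inr (w, s, t) := by
  change (if t = 0 then Sum.inl w else if t = 1 then Sum.inl (w.step s) else Sum.inr (w, s, t)) = _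
  rw [if_neg h0, if_neg h1]

theorem vertex_injective : Function.Injective (vertex (k := k)) := fun _ _ h => by
  simpa [normalForm_vertex] using congrArg normalForm h

theorem edge_ne_vertex (w w' : Vertex k) (s : Letter) {t : unitInterval} (h0 : t ≠ 0)
    (h1 : t ≠ 1) : edge w s t ≠ vertex w' := fun h => by
  simpa [normalForm_vertex, normalForm_edge w s h0 h1] using congrArg normalForm h

theorem edge_eq_vertex {w w' : Vertex k} {s : Letter} {t : unitInterval} :
    edge w s t = vertex w' ↔ (t = 0 ∧ w = w') ∨ (t = 1 ∧ w.step s = w') := by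
  by_cases h0 : t = 0
  · simp [h0, vertex_injective.eq_iff]
  by_cases h1 : t = 1
  · simp [h1, vertex_injective.eq_iff]
  simpa [h0, h1] using edge_ne_vertex w w' s h0 h1

theorem edge_inj {w w' : Vertex k} {s s' : Letter} {t t' : unitInterval} (h0 : t ≠ 0)
    (h1 : t ≠ 1) (h : edge w s t = edge w' s' t') : w = w' ∧ s = s' ∧ t = t' := by
  have h0' : t' ≠ 0 := by
    rintro rfl
    exact edge_ne_vertex w w' s h0 h1 (h.trans (edge_zero w' s'))
  have h1' : t' ≠ 1 := by
    rintro rfl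
    exact edge_ne_vertex w _ s h0 h1 (h.trans (edge_one w' s'))
  simpa [normalForm_edge _ _ h0 h1, normalForm_edge _ _ h0' h1'] using congrArg normalForm h

theorem isOpen_of_forall_edge {S : Set (Graph k)} (h : ∀ w s, IsOpen (edge w s ⁻¹' S)) :
    IsOpen S := by
  refine isQuotientMap_quot_mk.isOpen_preimage.1 (isOpen_sum_iff.2 ⟨isOpen_discrete _, ?_⟩)
  have : (Sum.inr ⁻¹' (Quot.mk (Glue k) ⁻¹' S) : Set (Vertex k × Letter × unitInterval)) =
      ⋃ e : Vertex k × Letter, {e.1} ×ˢ ({e.2} ×ˢ (edge e.1 e.2 ⁻¹' S)) := by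
    ext ⟨w, s, t⟩
    simp only [mem_iUnion, mem_prod, mem_singleton_iff, Prod.exists]
    exact ⟨fun h => ⟨w, s, rfl, rfl, h⟩, by rintro ⟨w', s', rfl, rfl, h⟩; exact h⟩
  rw [this]
  exact isOpen_iUnion fun e => (isOpen_discrete _).prod ((isOpen_discrete _).prod (h _ _))

/-- The interior of an edge. -/
def openEdge (e : Vertex k × Letter) : Set (Graph k) := edge e.1 e.2 '' {t | t ≠ 0 ∧ t ≠ 1}

theorem mem_openEdge {e : Vertex k × Letter} {w : Vertex k} {s : Letter} {t : unitInterval} :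
    edge w s t ∈ openEdge e ↔ e = (w, s) ∧ t ≠ 0 ∧ t ≠ 1 := by
  constructor
  · rintro ⟨t', ⟨h0, h1⟩, h⟩
    obtain ⟨h2, h3, rfl⟩ := edge_inj h0 h1 h
    exact ⟨Prod.ext h2 h3, h0, h1⟩
  · rintro ⟨rfl, h⟩
    exact ⟨t, h, rfl⟩

theorem isOpen_openEdge (e : Vertex k × Letter) : IsOpen (openEdge e) := by
  refine isOpen_of_forall_edge fun w s => ?_
  have : edge w s ⁻¹' openEdge e = {_t | e = (w, s)} ∩ ({0}ᶜ ∩ {1}ᶜ) := by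
    ext t
    exact mem_openEdge
  rw [this]
  exact isOpen_const.inter (isOpen_compl_singleton.inter isOpen_compl_singleton)

theorem openEdge_inj {e e' : Vertex k × Letter} (h : (openEdge e ∩ openEdge e').Nonempty) :
    e = e' := by
  obtain ⟨x, hx, hx'⟩ := h
  obtain ⟨w, s, t, rfl⟩ := exists_eq_edge x
  rw [(mem_openEdge.1 hx).1, (mem_openEdge.1 hx').1]

/-- The points of the edges at `w` with distance less than `1 / 2` from `w`. -/
def halfStar (w : Vertex k) : Set (Graph k) :=
  {x | Quot.lift
    (Sum.elim (fun w' => w' = w) fun e : Vertex k × Letter × unitInterval =>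
      ((e.2.2 : ℝ) < 1 / 2 ∧ e.1 = w) ∨ (1 / 2 < (e.2.2 : ℝ) ∧ e.1.step e.2.1 = w))
    (by rintro _ _ (⟨w', s⟩ | ⟨w', s⟩) <;> norm_num) x}

theorem mem_halfStar {w w' : Vertex k} {s : Letter} {t : unitInterval} :
    edge w' s t ∈ halfStar w ↔
      ((t : ℝ) < 1 / 2 ∧ w' = w) ∨ (1 / 2 < (t : ℝ) ∧ w'.step s = w) := Iff.rfl

theorem isOpen_halfStar (w : Vertex k) : IsOpen (halfStar w) := by
  refine isOpen_of_forall_edge fun w' s => ?_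
  change IsOpen (({t : unitInterval | (t : ℝ) < 1 / 2} ∩ {_t | w' = w}) ∪
      ({t : unitInterval | 1 / 2 < (t : ℝ)} ∩ {_t | w'.step s = w}))
  exact ((isOpen_lt continuous_subtype_val continuous_const).inter isOpen_const).union
    ((isOpen_lt continuous_const continuous_subtype_val).inter isOpen_const)

theorem halfStar_inj {w w' : Vertex k} (h : (halfStar w ∩ halfStar w').Nonempty) :
    w = w' := by
  obtain ⟨x, hx, hx'⟩ := h
  obtain ⟨u, s, t, rfl⟩ := exists_eq_edge x
  rw [mem_halfStar] at hx hx'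
  rcases hx with ⟨h1, rfl⟩ | ⟨h1, rfl⟩ <;> rcases hx' with ⟨h2, rfl⟩ | ⟨h2, rfl⟩ <;>
    first | rfl | linarith

end Graph

open Schori.Graph

/-! ### The points of the continuum -/

theorem continuous_coord (k : ℕ) : Continuous fun x : Continuum => x.1 k :=
  (continuous_apply k).comp continuous_subtype_val

/-- The point with parameter `t` of the `s`-edge of `Λ` that starts at the vertex with address
`u`. -/
noncomputable def point (u : Address) (s : Letter) (t : unitInterval) : Continuum :=
  ⟨fun k => edge (toVertex k u) s t, fun k => by rw [bonding_edge, proj_toVertex]⟩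

/-- The vertex of `Λ` with address `u`. -/
noncomputable def node (u : Address) : Continuum :=
  ⟨fun k => vertex (toVertex k u), fun k => by rw [bonding_vertex, proj_toVertex]⟩

@[simp] theorem point_zero (u : Address) (s : Letter) : point u s 0 = node u :=
  Subtype.ext (funext fun _ => edge_zero _ _)

@[simp] theorem point_one (u : Address) (s : Letter) : point u s 1 = node (odometer s u) :=
  Subtype.ext (funext fun k => by
    change edge _ _ _ = vertex _
    rw [edge_one, toVertex_odometer])

theorem continuous_point (u : Address) (s : Letter) : Continuous (point u s) :=
  Continuous.subtype_mk (continuous_pi fun _ => continuous_edge _ _) _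

theorem address_ext {u w : Address} (h : ∀ k, toVertex k u = toVertex k w) : u = w :=
  funext fun i => toVertex_eq_iff.1 (h (i + 1)) i (Nat.lt_succ_self i)

theorem node_injective : Function.Injective node := fun _ _ h =>
  address_ext fun k => vertex_injective (congrFun (congrArg Subtype.val h) k)

theorem point_inj {u u' : Address} {s s' : Letter} {t t' : unitInterval} (h0 : t ≠ 0)
    (h1 : t ≠ 1) (h : point u s t = point u' s' t') : u = u' ∧ s = s' ∧ t = t' := by
  have h' := fun k => edge_inj h0 h1 (congrFun (congrArg Subtype.val h) k)
  exact ⟨address_ext fun k => (h' k).1, (h' 0).2⟩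

theorem point_eq_node {u u' : Address} {s : Letter} {t : unitInterval} :
    point u s t = node u' ↔ (t = 0 ∧ u = u') ∨ (t = 1 ∧ odometer s u = u') := by
  by_cases h0 : t = 0
  · simp [h0, node_injective.eq_iff]
  by_cases h1 : t = 1
  · simp [h1, node_injective.eq_iff]
  simp only [h0, h1, false_and, or_self, iff_false]
  exact fun h => edge_ne_vertex _ _ _ h0 h1 (congrFun (congrArg Subtype.val h) 0)

theorem Continuum.IsVertex.exists_node {v : Continuum} (hv : v.IsVertex) : ∃ u, v = node u := by
  choose w hw using hv
  obtain ⟨u, hu⟩ := exists_address w fun k => vertex_injective <| by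
    rw [← bonding_vertex, ← hw, v.2, hw]
  exact ⟨u, Subtype.ext (funext fun k => by rw [hw, ← hu]; rfl)⟩

/-- Bonding maps keep label and parameter of an edge. So either all coordinates are interior points
of edges with the same label and parameter, or all are vertices. -/
theorem exists_eq_point (x : Continuum) : ∃ u s t, x = point u s t := by
  choose w s t h using fun k => exists_eq_edge (x.1 k)
  have hb : ∀ k, edge (Vertex.proj k (w (k + 1))) (s (k + 1)) (t (k + 1)) =
      edge (w k) (s k) (t k) := fun k => by rw [← bonding_edge, ← h, x.2, h]
  by_cases ht : t 0 ≠ 0 ∧ t 0 ≠ 1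
  · have hst : ∀ k, s k = s 0 ∧ t k = t 0 := by
      intro k
      induction k with
      | zero => exact ⟨rfl, rfl⟩
      | succ k ih =>
        rw [← ih.1, ← ih.2]
        rw [← ih.2] at ht
        exact ((edge_inj ht.1 ht.2 (hb k).symm).2.imp Eq.symm Eq.symm)
    obtain ⟨u, hu⟩ := exists_address w fun k =>
      (edge_inj (by rw [(hst k).2]; exact ht.1) (by rw [(hst k).2]; exact ht.2) (hb k).symm).1.symm
    refine ⟨u, s 0, t 0, Subtype.ext (funext fun k => ?_)⟩
    rw [h, ← hu, (hst k).1, (hst k).2]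
    rfl
  · have hv : x.IsVertex := by
      intro k
      have hk : ¬ (t k ≠ 0 ∧ t k ≠ 1) := by
        induction k with
        | zero => exact ht
        | succ k ih =>
          intro h'
          exact ih ((edge_inj h'.1 h'.2 (hb k)).2.2 ▸ h')
      rw [h]
      by_cases h0 : t k = 0
      · exact ⟨w k, by rw [h0, edge_zero]⟩
      · rw [not_not.1 fun h1 => hk ⟨h0, h1⟩]
        exact ⟨_, edge_one _ _⟩
    obtain ⟨u, rfl⟩ := hv.exists_node
    exact ⟨u, .a, 0, (point_zero _ _).symm⟩

/-! ### Stars in the leaf topology -/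

/-- The space `Λ` with the leaf topology. -/
def LeafSpace : Type := Continuum

instance : TopologicalSpace LeafSpace := leafTopology Continuum

/-- The underlying point of `Λ`. -/
def LeafSpace.pt (x : LeafSpace) : Continuum := x

/-- The union of the open stars of the vertices in `R`. -/
def star (R : Set Address) : Set Continuum :=
  {y | ∃ u s t, y = point u s t ∧ ((u ∈ R ∧ t ≠ 1) ∨ (odometer s u ∈ R ∧ t ≠ 0))}

theorem node_mem_star {R : Set Address} {u : Address} (h : u ∈ R) : node u ∈ star R :=
  ⟨u, .a, 0, (point_zero _ _).symm, Or.inl ⟨h, zero_ne_one⟩⟩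

theorem point_mem_star {R : Set Address} {u : Address} {s : Letter} {t : unitInterval} :
    point u s t ∈ star R ↔ (u ∈ R ∧ t ≠ 1) ∨ (odometer s u ∈ R ∧ t ≠ 0) := by
  refine ⟨?_, fun h => ⟨u, s, t, rfl, h⟩⟩
  have key : ∀ w ∈ R, point u s t = node w → (u ∈ R ∧ t ≠ 1) ∨ (odometer s u ∈ R ∧ t ≠ 0) := by
    intro w hw h
    rcases point_eq_node.1 h with ⟨rfl, rfl⟩ | ⟨rfl, rfl⟩
    · exact Or.inl ⟨hw, zero_ne_one⟩
    · exact Or.inr ⟨hw, one_ne_zero⟩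
  rintro ⟨u', s', t', he, h⟩
  by_cases h0 : t' = 0
  · subst h0
    rw [point_zero] at he
    exact key u' (by simpa using h) he
  by_cases h1 : t' = 1
  · subst h1
    rw [point_one] at he
    exact key _ (by simpa using h) he
  obtain ⟨rfl, rfl, rfl⟩ := point_inj h0 h1 he.symm
  exact h

/-- Around each point an open set is pulled back from the one-vertex graph `Λ_0`: all edges without
their midpoints, or all open edges. In every coordinate a path component then stays in one half star
or one open edge, which pins down the whole address. -/
theorem isOpen_star (R : Set Address) : IsOpen (LeafSpace.pt ⁻¹' star R) := by
  refine isOpen_leafTopology_of_forall (X := Continuum) fun y hy => ?_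
  change y ∈ star R at hy
  change ∃ U, _ ∧ _ ∧ _ ⊆ star R
  have key : ∀ u ∈ R, ∃ U : Set Continuum, IsOpen U ∧ node u ∈ U ∧
      pathComponentIn U (node u) ⊆ star R := by
    intro u hu
    refine ⟨(fun x => x.1 0) ⁻¹' ⋃ w, halfStar w,
      (isOpen_iUnion isOpen_halfStar).preimage (continuous_coord 0), ?_, ?_⟩
    · refine mem_iUnion.2 ⟨toVertex 0 u, ?_⟩
      rfl
    · intro z hz
      obtain ⟨u', s, t, rfl⟩ := exists_eq_point z
      have hk : ∀ k, edge (toVertex k u') s t ∈ halfStar (toVertex k u) := by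
        intro k
        refine pathComponentIn_subset_preimage (continuous_coord k) isOpen_halfStar
          (fun _ _ => halfStar_inj) ?_ (x := node u) rfl hz
        intro x hx
        obtain ⟨u', s, t, rfl⟩ := exists_eq_point x
        obtain ⟨w, hw⟩ := mem_iUnion.1 hx
        rcases mem_halfStar.1 hw with ⟨h, -⟩ | ⟨h, -⟩
        · exact ⟨_, mem_halfStar.2 (Or.inl ⟨h, rfl⟩)⟩
        · exact ⟨_, mem_halfStar.2 (Or.inr ⟨h, rfl⟩)⟩
      rw [point_mem_star]
      rcases mem_halfStar.1 (hk 0) with ⟨h, -⟩ | ⟨h, -⟩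
      · have hu' : u' = u := address_ext fun k =>
          ((mem_halfStar.1 (hk k)).resolve_right fun h' => by linarith [h'.1]).2
        refine Or.inl ⟨hu' ▸ hu, ?_⟩
        rintro rfl
        norm_num at h
      · have hu' : odometer s u' = u := address_ext fun k => by
          rw [toVertex_odometer]
          exact ((mem_halfStar.1 (hk k)).resolve_left fun h' => by linarith [h'.1]).2
        refine Or.inr ⟨hu' ▸ hu, ?_⟩
        rintro rfl
        norm_num at h
  obtain ⟨u, s, t, rfl, h⟩ := hy
  by_cases h0 : t = 0
  · subst h0
    rw [point_zero]
    exact key u (by simpa using h)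
  by_cases h1 : t = 1
  · subst h1
    rw [point_one]
    exact key _ (by simpa using h)
  refine ⟨(fun x => x.1 0) ⁻¹' ⋃ e, openEdge e,
    (isOpen_iUnion isOpen_openEdge).preimage (continuous_coord 0), ?_, ?_⟩
  · exact mem_iUnion.2 ⟨(toVertex 0 u, s), mem_openEdge.2 ⟨rfl, h0, h1⟩⟩
  · intro z hz
    obtain ⟨u', s', t', rfl⟩ := exists_eq_point z
    have hk : ∀ k, edge (toVertex k u') s' t' ∈ openEdge (toVertex k u, s) := by
      intro k
      refine pathComponentIn_subset_preimage (continuous_coord k) isOpen_openEdge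
        (fun _ _ => openEdge_inj) ?_ (x := point u s t) (mem_openEdge.2 ⟨rfl, h0, h1⟩) hz
      intro x hx
      obtain ⟨u', s, t, rfl⟩ := exists_eq_point x
      obtain ⟨e, he⟩ := mem_iUnion.1 hx
      exact ⟨_, mem_openEdge.2 ⟨rfl, (mem_openEdge.1 he).2⟩⟩
    have hu : u = u' := address_ext fun k => congrArg Prod.fst (mem_openEdge.1 (hk k)).1
    have hs : s = s' := congrArg Prod.snd (mem_openEdge.1 (hk 0)).1
    subst hu hs
    rw [point_mem_star]
    obtain ⟨-, h2, h3⟩ := mem_openEdge.1 (hk 0)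
    exact h.imp (And.imp_right fun _ => h3) (And.imp_right fun _ => h2)

/-- The space and its edge maps are arbitrary because the lemma serves `Λ`, the leaf topology and
the finite graphs `Λ_k`. -/
theorem Linked.joinedIn {X : Type*} [TopologicalSpace X] {E : Address → Letter → unitInterval → X}
    {p : Address → X} (hE : ∀ u s, Continuous (E u s)) (h0 : ∀ u s, E u s 0 = p u)
    (h1 : ∀ u s, E u s 1 = p (odometer s u)) {S : Set Address} {T : Set X}
    (hT : ∀ u s t, u ∈ S → odometer s u ∈ S → E u s t ∈ T) (hp : ∀ u ∈ S, p u ∈ T)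
    {u w : Address} (h : Linked S u w) : JoinedIn T (p u) (p w) := by
  induction h with
  | refl hu => exact JoinedIn.refl (hp _ hu)
  | edge s hu hs =>
    rw [← h0 _ s, ← h1]
    exact joinedIn_image_unitInterval (hE _ _) fun t _ => hT _ _ t hu hs
  | symm _ ih => exact ih.symm
  | trans _ _ ih1 ih2 => exact ih1.trans ih2

theorem Linked.joined {S : Set Address} {u w : Address} (h : Linked S u w) :
    Joined (node u) (node w) :=
  (h.joinedIn (T := univ) continuous_point point_zero point_one (fun _ _ _ _ _ => trivial)
    fun _ _ => trivial).joined

/-- The point `point u s t` of `Λ` with the leaf topology. -/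
noncomputable def leafPoint (u : Address) (s : Letter) (t : unitInterval) : LeafSpace := point u s t

/-- The vertex `node u` of `Λ` with the leaf topology. -/
noncomputable def leafNode (u : Address) : LeafSpace := node u

theorem continuous_leafPoint (u : Address) (s : Letter) : Continuous (leafPoint u s) :=
  (continuous_point u s).leafTopology

theorem leafPoint_zero (u : Address) (s : Letter) : leafPoint u s 0 = leafNode u := point_zero u s

theorem leafPoint_one (u : Address) (s : Letter) : leafPoint u s 1 = leafNode (odometer s u) :=
  point_one u s

theorem isPreconnected_star {R : Set Address} (hR : ∀ u ∈ R, ∀ w ∈ R, Linked R u w) :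
    IsPreconnected (LeafSpace.pt ⁻¹' star R) := by
  have key : ∀ y ∈ LeafSpace.pt ⁻¹' star R,
      ∃ w ∈ R, JoinedIn (LeafSpace.pt ⁻¹' star R) y (leafNode w) := by
    rintro y ⟨u, s, t, he, h⟩
    obtain rfl : y = leafPoint u s t := he
    rcases h with h | h
    · refine ⟨u, h.1, ?_⟩
      rw [← leafPoint_zero u s]
      refine joinedIn_image_unitInterval (continuous_leafPoint u s) fun c hc =>
        point_mem_star.2 (Or.inl ⟨h.1, ?_⟩)
      rw [uIcc_of_ge unitInterval.nonneg'] at hc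
      exact (hc.2.trans_lt (unitInterval.le_one'.lt_of_ne h.2)).ne
    · refine ⟨_, h.1, ?_⟩
      rw [← leafPoint_one u s]
      refine joinedIn_image_unitInterval (continuous_leafPoint u s) fun c hc =>
        point_mem_star.2 (Or.inr ⟨h.1, ?_⟩)
      rw [uIcc_of_le unitInterval.le_one'] at hc
      exact ((unitInterval.nonneg'.lt_of_ne' h.2).trans_le hc.1).ne'
  refine isPreconnected_of_forall_pair fun y hy z hz => ?_
  obtain ⟨u, hu, hyu⟩ := key y hy
  obtain ⟨w, hw, hzw⟩ := key z hz
  have huw : JoinedIn (LeafSpace.pt ⁻¹' star R) (leafNode u) (leafNode w) :=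
    (hR u hu w hw).joinedIn continuous_leafPoint leafPoint_zero leafPoint_one
      (fun u s t hu hs => point_mem_star.2 <| by
        by_cases h : t = 1
        · exact Or.inr ⟨hs, h ▸ one_ne_zero⟩
        · exact Or.inl ⟨hu, h⟩) fun _ => node_mem_star
  obtain ⟨γ, hγ⟩ := (hyu.trans huw).trans hzw.symm
  exact ⟨range γ, range_subset_iff.2 hγ, ⟨0, γ.source⟩, ⟨1, γ.target⟩,
    isPreconnected_range γ.continuous⟩

/-- For invariant `R` every edge has both ends in `R` or both outside, so `star R` and `star Rᶜ` are
disjoint leaf-open sets that cover `Λ`, and a path cannot leave the first. -/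
theorem pathComponent_subset_star {R : Set Address} (hR : ∀ u s, odometer s u ∈ R ↔ u ∈ R)
    {u : Address} (hu : u ∈ R) : pathComponent (node u) ⊆ star R := by
  rintro y ⟨γ⟩
  let f : unitInterval → LeafSpace := γ
  have hf : Continuous f := γ.continuous.leafTopology
  have h : (univ : Set unitInterval) ⊆ f ⁻¹' (LeafSpace.pt ⁻¹' star R) := by
    refine IsPreconnected.subset_left_of_subset_union ((isOpen_star R).preimage hf)
      ((isOpen_star Rᶜ).preimage hf) ?_ ?_ ⟨0, trivial, ?_⟩ isPreconnected_univ
    · refine disjoint_left.2 fun t ht ht' => ?_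
      obtain ⟨w, s, r, hw⟩ := exists_eq_point (f t).pt
      rw [mem_preimage, mem_preimage, hw, point_mem_star] at ht ht'
      simp only [mem_compl_iff, hR] at ht ht'
      tauto
    · intro t _
      obtain ⟨w, s, r, hw⟩ := exists_eq_point (f t).pt
      rw [mem_union, mem_preimage, mem_preimage, mem_preimage, mem_preimage, hw, point_mem_star, point_mem_star]
      simp only [hR, mem_compl_iff]
      have : r ≠ 0 ∨ r ≠ 1 := by
        by_cases h : r = 0
        · exact Or.inr (h ▸ zero_ne_one)
        · exact Or.inl h
      tauto
    · rw [mem_preimage, mem_preimage, show (f 0).pt = node u from γ.source]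
      exact node_mem_star hu
  rw [← γ.target]
  exact h (mem_univ 1)

/-! ### Leaves with a height function -/

/-- A height function on an orbit of addresses whose level sets are finite and whose strict upper
and lower sets are connected. -/
structure HeightFunction (R : Set Address) (h : Address → ℤ) : Prop where
  invariant : ∀ u s, odometer s u ∈ R ↔ u ∈ R
  step : ∀ u ∈ R, ∀ s, |h (odometer s u) - h u| ≤ 1
  finite : ∀ n : ℕ, {u ∈ R | |h u| ≤ n}.Finite
  linked : ∀ u ∈ R, ∀ w ∈ R, Linked R u w
  linked_pos : ∀ n : ℕ, ∀ u ∈ R, n < h u → ∀ w ∈ R, n < h w → Linked {u ∈ R | n < h u} u w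
  linked_neg : ∀ n : ℕ, ∀ u ∈ R, n < -h u → ∀ w ∈ R, n < -h w → Linked {u ∈ R | n < -h u} u w
  exists_pos : ∀ n : ℕ, ∃ u ∈ R, n < h u
  exists_neg : ∀ n : ℕ, ∃ u ∈ R, n < -h u

theorem star_mono {R S : Set Address} (h : R ⊆ S) : star R ⊆ star S := by
  rintro _ ⟨u, s, t, rfl, hu⟩
  exact point_mem_star.2 (hu.imp (And.imp_left (@h _)) (And.imp_left (@h _)))

theorem star_union (R S : Set Address) : star (R ∪ S) = star R ∪ star S := by
  refine Subset.antisymm ?_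
    (union_subset (star_mono subset_union_left) (star_mono subset_union_right))
  rintro _ ⟨u, s, t, rfl, hu⟩
  rw [mem_union, point_mem_star, point_mem_star]
  simp only [mem_union] at hu
  tauto

/-- The part in a leaf of the union of the open stars of the vertices in `R`. -/
def leafStar (v : Continuum) (R : Set Address) : Set (Leaf v) := {y | y.1 ∈ star R}

theorem leafStar_mono {v : Continuum} {R S : Set Address} (h : R ⊆ S) :
    leafStar v R ⊆ leafStar v S := fun _ hy => star_mono h hy

theorem isOpen_leafStar (v : Continuum) (R : Set Address) : IsOpen (leafStar v R) :=
  ⟨LeafSpace.pt ⁻¹' star R, isOpen_star R, rfl⟩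

/-- The inclusion of a leaf. -/
def Leaf.toLeafSpace {v : Continuum} (y : Leaf v) : LeafSpace := y.1

theorem isInducing_toLeafSpace (v : Continuum) : IsInducing (Leaf.toLeafSpace (v := v)) := ⟨rfl⟩

namespace HeightFunction

variable {R : Set Address} {h : Address → ℤ}

theorem point_mem_leaf (H : HeightFunction R h) {x u : Address} (hx : x ∈ R) (hu : u ∈ R)
    (s : Letter) (t : unitInterval) : point u s t ∈ pathComponent (node x) := by
  have h1 : JoinedIn univ (point u s 0) (point u s t) :=
    joinedIn_image_unitInterval (continuous_point u s) fun _ _ => trivial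
  rw [point_zero] at h1
  exact ((H.linked x hx u hu).joined).trans h1.joined

theorem exists_leaf_eq_point (H : HeightFunction R h) {x : Address} (hx : x ∈ R)
    (y : Leaf (node x)) : ∃ u s t, y.1 = point u s t ∧ u ∈ R ∧ odometer s u ∈ R := by
  obtain ⟨u, s, t, he, hu⟩ := pathComponent_subset_star H.invariant hx y.2
  rw [H.invariant] at hu
  have hu' : u ∈ R := hu.elim And.left And.left
  exact ⟨u, s, t, he, hu', (H.invariant u s).2 hu'⟩

theorem isPreconnected_leafStar (H : HeightFunction R h) {x : Address} (hx : x ∈ R)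
    {S : Set Address} (hSR : S ⊆ R) (hS : ∀ u ∈ S, ∀ w ∈ S, Linked S u w) :
    IsPreconnected (leafStar (node x) S) := by
  rw [← (isInducing_toLeafSpace (node x)).isPreconnected_image]
  convert isPreconnected_star hS
  refine Subset.antisymm (by rintro _ ⟨y, hy, rfl⟩; exact hy) ?_
  rintro y ⟨u, s, t, he, hu⟩
  obtain rfl : y = leafPoint u s t := he
  have huR : u ∈ R := hu.elim (fun h => hSR h.1) fun h => (H.invariant u s).1 (hSR h.1)
  exact ⟨⟨_, H.point_mem_leaf hx huR s t⟩, point_mem_star.2 hu, rfl⟩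

theorem isCompact_edge (H : HeightFunction R h) {x u : Address} (hx : x ∈ R) (hu : u ∈ R)
    (s : Letter) : IsCompact {y : Leaf (node x) | y.1 ∈ range (point u s)} := by
  rw [(isInducing_toLeafSpace (node x)).isCompact_iff]
  convert isCompact_range (continuous_leafPoint u s)
  refine Subset.antisymm (by rintro _ ⟨y, hy, rfl⟩; exact hy) ?_
  rintro _ ⟨t, rfl⟩
  exact ⟨⟨_, H.point_mem_leaf hx hu s t⟩, ⟨t, rfl⟩, rfl⟩

/-- The compact set is the subgraph spanned by the vertices with `|h| ≤ n`, closed inside finitely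
many edges. The two remaining parts are stars of the vertices above and below. -/
theorem twoEnded (H : HeightFunction R h) {x : Address} (hx : x ∈ R) :
    SpaceEnds.TwoEnded
      (fun n : ℕ => (leafStar (node x) {u ∈ R | n < |h u|})ᶜ)
      (fun n : ℕ => leafStar (node x) {u ∈ R | n < h u})
      (fun n : ℕ => leafStar (node x) {u ∈ R | n < -h u}) where
  isCompact n := by
    have hK : IsCompact (⋃ u ∈ {u ∈ R | |h u| ≤ n}, ⋃ s : Letter,
        {y : Leaf (node x) | y.1 ∈ range (point u s)}) :=
      (H.finite n).isCompact_biUnion fun u hu => isCompact_iUnion fun s =>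
        H.isCompact_edge hx hu.1 s
    refine hK.of_isClosed_subset (isOpen_leafStar _ _).isClosed_compl fun y hy => ?_
    obtain ⟨u, s, t, he, hu, hsu⟩ := H.exists_leaf_eq_point hx y
    have hy' : y.1 ∉ star {u ∈ R | n < |h u|} := hy
    rw [he] at hy'
    simp only [point_mem_star, mem_ofPred_eq, hu, hsu, true_and, not_or, not_and, not_not] at hy'
    simp only [mem_iUnion]
    by_cases ht : t = 1
    -- At `t = 1` the start `u` of the edge may be too high, so the point is taken as the start of
    -- an edge at the other endpoint.
    · refine ⟨odometer s u, ⟨hsu, ?_⟩, s, 0, ?_⟩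
      · by_contra h'
        exact one_ne_zero (ht.symm.trans (hy'.2 (not_le.1 h')))
      · rw [he, ht, point_one]
        exact point_zero _ s
    · refine ⟨u, ⟨hu, ?_⟩, s, t, he.symm⟩
      by_contra h'
      exact ht (hy'.1 (not_le.1 h'))
  mono m n hmn := compl_subset_compl.2 (leafStar_mono
    fun u hu => ⟨hu.1, lt_of_le_of_lt (by exact_mod_cast hmn) hu.2⟩)
  exists_mem_nhds y := by
    obtain ⟨u, s, t, he, hu, hsu⟩ := H.exists_leaf_eq_point hx y
    set m := max (h u).natAbs (h (odometer s u)).natAbs with hm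
    -- An edge with one end of height at most `m` has its other end of height at most `m + 1`, so
    -- the open star lies in the compact set.
    refine ⟨m + 1, Filter.mem_of_superset
      ((isOpen_leafStar (node x) {w ∈ R | |h w| ≤ m}).mem_nhds ?_) fun z hz hz' => ?_⟩
    · change y.1 ∈ star _
      rw [he, point_mem_star]
      by_cases ht : t = 1
      · exact Or.inr ⟨⟨hsu, by rw [abs_le]; omega⟩, ht ▸ one_ne_zero⟩
      · exact Or.inl ⟨⟨hu, by rw [abs_le]; omega⟩, ht⟩
    · obtain ⟨w, r, q, hz1, hw, hrw⟩ := H.exists_leaf_eq_point hx z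
      have h1 : z.1 ∈ star _ := hz
      have h2 : z.1 ∈ star _ := hz'
      rw [hz1, point_mem_star] at h1 h2
      have h3 := abs_le.1 (H.step w hw r)
      simp only [mem_ofPred_eq, hw, hrw, true_and, Nat.cast_add, Nat.cast_one] at h1 h2
      rcases h1 with ⟨h1, -⟩ | ⟨h1, -⟩ <;> rcases h2 with ⟨h2, -⟩ | ⟨h2, -⟩ <;>
        rw [abs_le] at h1 <;> rw [lt_abs] at h2 <;> omega
  compl_eq n := by
    rw [compl_compl]
    have : {u ∈ R | (n : ℤ) < |h u|} = {u ∈ R | (n : ℤ) < h u} ∪ {u ∈ R | (n : ℤ) < -h u} := by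
      ext u
      simp [lt_abs, and_or_left]
    ext y
    change y.1 ∈ star _ ↔ y.1 ∈ star _ ∨ y.1 ∈ star _
    rw [this, star_union]
    rfl
  isOpen_pos n := isOpen_leafStar _ _
  isOpen_neg n := isOpen_leafStar _ _
  disj n := by
    refine disjoint_left.2 fun y hy hy' => ?_
    obtain ⟨u, s, t, he, hu, hsu⟩ := H.exists_leaf_eq_point hx y
    have h1 : y.1 ∈ star _ := hy
    have h2 : y.1 ∈ star _ := hy'
    rw [he, point_mem_star] at h1 h2
    -- An edge meeting both stars would join heights at least `n + 1` and at most `-(n + 1)`, a jump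
    -- of at least `2`.
    have h3 := abs_le.1 (H.step u hu s)
    simp only [mem_ofPred_eq] at h1 h2
    omega
  anti_pos m n hmn := leafStar_mono
    fun u hu => ⟨hu.1, lt_of_le_of_lt (by exact_mod_cast hmn) hu.2⟩
  anti_neg m n hmn := leafStar_mono
    fun u hu => ⟨hu.1, lt_of_le_of_lt (by exact_mod_cast hmn) hu.2⟩
  conn_pos n := by
    refine ⟨?_, H.isPreconnected_leafStar hx (fun u hu => hu.1) fun u hu w hw =>
      H.linked_pos n u hu.1 hu.2 w hw.1 hw.2⟩
    obtain ⟨u, hu, hn⟩ := H.exists_pos n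
    exact ⟨⟨node u, (H.linked x hx u hu).joined⟩, node_mem_star ⟨hu, hn⟩⟩
  conn_neg n := by
    refine ⟨?_, H.isPreconnected_leafStar hx (fun u hu => hu.1) fun u hu w hw =>
      H.linked_neg n u hu.1 hu.2 w hw.1 hw.2⟩
    obtain ⟨u, hu, hn⟩ := H.exists_neg n
    exact ⟨⟨node u, (H.linked x hx u hu).joined⟩, node_mem_star ⟨hu, hn⟩⟩

end HeightFunction

end Schori

namespace Schori

/-! ### The orbit of an address with almost all digits in `{0, s}` -/

theorem odometer_apply_of_lt {t : Letter} {u : Address} {i j : ℕ} (hj : u j ≠ some t)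
    (hij : j < i) : odometer t u i = u i := by
  rw [odometer_apply, if_neg fun h => hj (h j hij)]

theorem odometer_symm_apply_of_lt {t : Letter} {u : Address} {i j : ℕ} (hj : u j ≠ none)
    (hij : j < i) : (odometer t).symm u i = u i := by
  rw [odometer_symm_apply, if_neg fun h => hj (h j hij)]

theorem odometer_eq_other_iff {s : Letter} {u : Address} {i : ℕ} :
    odometer s u i = some s.other ↔ u i = some s.other := by
  rw [odometer_apply]
  split_ifs with h
  · rw [← (flip s).apply_eq_iff_eq (x := u i), flip_of_ne s.other_ne]
  · rfl

theorem zpow_invariant {X : Type*} {σ : Equiv.Perm X} {p : X → Prop} (h : ∀ u, p (σ u) ↔ p u)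
    (j : ℤ) (u : X) : p ((σ ^ j) u) ↔ p u := by
  induction j generalizing u with
  | zero => rfl
  | succ j ih => rw [zpow_add_one, Equiv.Perm.mul_apply, ih, h]
  | pred j ih =>
    rw [zpow_sub_one, Equiv.Perm.mul_apply, ih, ← h, ← Equiv.Perm.mul_apply, mul_inv_cancel,
      Equiv.Perm.one_apply]

/-- The addresses that differ from `x` in finitely many digits only. -/
def cofinal (x : Address) : Set Address := {u | ∃ n, u ∈ tailSet n x}

theorem mem_cofinal_self (x : Address) : x ∈ cofinal x := ⟨0, mem_tailSet_self 0 x⟩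

theorem tailSet_subset_cofinal {x u : Address} (hu : u ∈ cofinal x) (n : ℕ) :
    tailSet n u ⊆ cofinal x := by
  obtain ⟨m, hm⟩ := hu
  intro w hw
  refine ⟨max m n, fun i hi => ?_⟩
  rw [hw i (by omega), hm i (by omega)]

/-- A carry stops at a digit different from `t` and a borrow at a nonzero digit; `x` has both
arbitrarily far out. -/
theorem odometer_mem_cofinal {x : Address} (hx : ∀ d n, ∃ i ≥ n, x i ≠ d) (u : Address)
    (t : Letter) : odometer t u ∈ cofinal x ↔ u ∈ cofinal x := by
  constructor
  · rintro ⟨n, hn⟩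
    obtain ⟨j, hj, hxj⟩ := hx none n
    refine ⟨j + 1, fun i hi => ?_⟩
    have h := odometer_symm_apply_of_lt (t := t) (u := odometer t u) (by rwa [hn j hj]) hi
    rw [Equiv.symm_apply_apply] at h
    rw [h, hn i (by omega)]
  · rintro ⟨n, hn⟩
    obtain ⟨j, hj, hxj⟩ := hx (some t) n
    refine ⟨j + 1, fun i hi => ?_⟩
    rw [← hn i (by omega), odometer_apply_of_lt (by rwa [hn j hj]) hi]

theorem erase_eq_erase {n : ℕ} {u w : Address} (h : ∀ i, n ≤ i → u i = w i) :
    erase n u = erase n w := by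
  funext i
  simp only [erase]
  split_ifs with hi
  · rfl
  · exact h i (not_lt.1 hi)

theorem linked_cofinal {x u w : Address} (hu : u ∈ cofinal x) (hw : w ∈ cofinal x) :
    Linked (cofinal x) u w := by
  obtain ⟨m, hm⟩ := id hu
  obtain ⟨n, hn⟩ := id hw
  have h1 := (linked_erase (max m n) u).mono (tailSet_subset_cofinal hu _)
  have h2 := (linked_erase (max m n) w).mono (tailSet_subset_cofinal hw _)
  rw [erase_eq_erase (w := w) fun i hi => by rw [hm i (by omega), hn i (by omega)]] at h1
  exact h1.trans h2.symm

theorem finite_tailSet (n : ℕ) (u : Address) : (tailSet n u).Finite := by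
  refine Set.Finite.of_injOn (f := fun (w : Address) (i : Fin n) => w i) (mapsTo_univ _ _) ?_
    (Set.toFinite univ)
  intro v hv w hw h
  funext i
  by_cases hi : i < n
  · exact congrFun h ⟨i, hi⟩
  · rw [hv i (not_lt.1 hi), hw i (not_lt.1 hi)]

/-! ### Projection of an orbit to its `s`-line -/

open scoped Classical in
/-- The address `u` with all digits up to the last digit `s.other` replaced by `0`. -/
noncomputable def ground (s : Letter) (u : Address) : Address :=
  fun i => if ∃ j ≥ i, u j = some s.other then none else u i

theorem ground_of_forall {s : Letter} {u : Address} {i : ℕ} (h : ∀ j ≥ i, u j ≠ some s.other) :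
    ground s u i = u i := if_neg fun ⟨j, hj, hj'⟩ => h j hj hj'

theorem ground_of_exists {s : Letter} {u : Address} {i j : ℕ} (hj : i ≤ j)
    (h : u j = some s.other) : ground s u i = none := if_pos ⟨j, hj, h⟩

theorem ground_congr {s : Letter} {u w : Address} {i : ℕ}
    (h : ∀ j ≥ i, u j = some s.other ↔ w j = some s.other)
    (hi : (∀ j ≥ i, u j ≠ some s.other) → u i = w i) : ground s u i = ground s w i := by
  by_cases hu : ∃ j ≥ i, u j = some s.other
  · obtain ⟨j, hj, huj⟩ := hu
    rw [ground_of_exists hj huj, ground_of_exists hj ((h j hj).1 huj)]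
  · push Not at hu
    rw [ground_of_forall hu, ground_of_forall fun j hj => (h j hj).not.1 (hu j hj), hi hu]

theorem ground_ne_other (s : Letter) (u : Address) (i : ℕ) : ground s u i ≠ some s.other := by
  by_cases hu : ∃ j ≥ i, u j = some s.other
  · obtain ⟨j, hj, huj⟩ := hu
    simp [ground_of_exists hj huj]
  · push Not at hu
    rw [ground_of_forall hu]
    exact hu i le_rfl

theorem ground_eq_self {s : Letter} {u : Address} (h : ∀ i, u i ≠ some s.other) :
    ground s u = u := funext fun _ => ground_of_forall fun j _ => h j

/-- A carry in the other letter passes only through digits `s.other` and ends by turning a `0` into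
`s.other` or at a digit `s`. Every digit it changes lies in positions where both grounds are `0`. -/
theorem ground_odometer_other (s : Letter) (u : Address) :
    ground s (odometer s.other u) = ground s u := by
  funext i
  by_cases hi : ∃ l < i, u l ≠ some s.other
  · obtain ⟨l, hl, hul⟩ := hi
    refine ground_congr (fun j hj => ?_) fun _ => ?_
    · rw [odometer_apply_of_lt hul (by omega)]
    · rw [odometer_apply_of_lt hul hl]
  push Not at hi
  have hoi : odometer s.other u i = flip s.other (u i) := by rw [odometer_apply, if_pos hi]
  by_cases hui : u i = some s.other
  · rw [ground_of_exists le_rfl hui]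
    by_cases h : ∃ j ≥ i, odometer s.other u j = some s.other
    · obtain ⟨j, hj, h⟩ := h
      exact ground_of_exists hj h
    · push Not at h
      rw [ground_of_forall h, hoi, hui, flip_self]
  · cases hd : u i with
    | none =>
      rw [ground_of_exists le_rfl (by rw [hoi, hd, flip_none])]
      by_cases h : ∃ j ≥ i, u j = some s.other
      · obtain ⟨j, hj, h⟩ := h
        exact (ground_of_exists hj h).symm
      · push Not at h
        rw [ground_of_forall h, hd]
    | some t =>
      have ht : t ≠ s.other := fun h => hui (by rw [hd, h])
      rw [hd, flip_of_ne ht, ← hd] at hoi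
      refine ground_congr (fun j hj => ?_) fun _ => hoi
      rcases hj.eq_or_lt with rfl | hj
      · rw [hoi]
      · rw [odometer_apply_of_lt hui hj]

/-- A carry in `s` stops no later than at the first digit `s.other`, so it changes only digits that
are erased anyway. -/
theorem ground_odometer_of_exists {s : Letter} {u : Address} (h : ∃ l, u l = some s.other) :
    ground s (odometer s u) = ground s u := by
  obtain ⟨l, hl⟩ := h
  funext i
  refine ground_congr (fun j _ => odometer_eq_other_iff) fun h => ?_
  refine odometer_apply_of_lt (j := l) (by rw [hl]; simpa using s.other_ne) ?_
  by_contra hi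
  exact h l (not_lt.1 hi) (odometer_eq_other_iff.2 hl)

theorem ground_odometer_of_forall {s : Letter} {u : Address} (h : ∀ l, u l ≠ some s.other) :
    ground s (odometer s u) = odometer s (ground s u) := by
  rw [ground_eq_self h, ground_eq_self fun l => odometer_eq_other_iff.not.2 (h l)]

theorem eq_none_or_of_ne_other {s : Letter} {d : Option Letter} (h : d ≠ some s.other) :
    d = none ∨ d = some s := by
  rcases d with _ | t
  · exact Or.inl rfl
  · rcases s.eq_or_eq_other t with rfl | rfl
    · exact Or.inr rfl
    · exact absurd rfl h

/-! ### The free `s`-orbit of an address with digits in `{0, s}` -/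

theorem exists_zpow_erase {s : Letter} {z : Address} (hz : ∀ i, z i ≠ some s.other) (n : ℕ) :
    ∃ j : ℤ, z = (odometer s ^ j) (erase n z) := by
  induction n with
  | zero => exact ⟨0, by funext i; simp [erase]⟩
  | succ n ih =>
    obtain ⟨j, hj⟩ := ih
    rcases eq_none_or_of_ne_other (hz n) with h | h
    · exact ⟨j, by rwa [erase_succ_of_none h]⟩
    -- A digit `s` in position `n` contributes `2^n` to the binary value.
    · refine ⟨j + (2 ^ n : ℕ), ?_⟩
      have h1 : (odometer s ^ 2 ^ n) (erase (n + 1) z) = erase n z := by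
        rw [odometer_pow, carry_of_none]
        · funext i
          rcases lt_trichotomy i n with hi | rfl | hi
          · rw [Function.update_of_ne hi.ne]
            simp [erase, hi, hi.trans (Nat.lt_succ_self n)]
          · simp [erase, h]
          · rw [Function.update_of_ne hi.ne']
            simp [erase, hi.not_gt, show ¬ i < n + 1 by omega]
        · simp [erase]
        · intro i hi
          simp [erase, show i < n + 1 by omega]
      rw [zpow_add, zpow_natCast, Equiv.Perm.mul_apply, h1, ← hj]

theorem exists_zpow_eq {s : Letter} {z w : Address} (hz : ∀ i, z i ≠ some s.other)
    (hw : ∀ i, w i ≠ some s.other) (h : w ∈ cofinal z) : ∃ j : ℤ, w = (odometer s ^ j) z := by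
  obtain ⟨n, hn⟩ := h
  obtain ⟨i, hi⟩ := exists_zpow_erase hz n
  obtain ⟨j, hj⟩ := exists_zpow_erase hw n
  rw [erase_eq_erase hn] at hj
  refine ⟨j - i, ?_⟩
  conv_rhs => rw [hi]
  rw [← Equiv.Perm.mul_apply, ← zpow_add, sub_add_cancel]
  exact hj

/-- Write `m = 2^k l` with `l` odd: `s^{2^k}` flips digit `k`, so `s^m` flips it an odd number of
times. -/
theorem pow_apply_ne {s : Letter} {z : Address} (hz : ∀ i, z i ≠ some s.other) {m : ℕ}
    (hm : m ≠ 0) : (odometer s ^ m) z ≠ z := by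
  obtain ⟨k, l, hl, rfl⟩ := Nat.exists_eq_two_pow_mul_odd hm
  have hb : ∀ u : Address, (∀ i, u i ≠ some s.other) → ∀ i, (odometer s ^ 2 ^ k) u i ≠
      some s.other := by
    intro u hu
    rw [← zpow_natCast]
    exact (zpow_invariant (p := fun u : Address => ∀ i, u i ≠ some s.other)
      (fun _ => forall_congr' fun _ => odometer_eq_other_iff.not) _ u).2 hu
  have h1 : ∀ u : Address, (∀ i, u i ≠ some s.other) →
      (odometer s ^ 2 ^ k) u k = flip s (u k) := by
    intro u hu
    rw [odometer_pow fun i _ => eq_none_or_of_ne_other (hu i), carry,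
      if_pos ⟨le_rfl, fun j h1 h2 => absurd h1 (by omega)⟩]
  have h2 : ∀ l, ∀ u : Address, (∀ i, u i ≠ some s.other) →
      ((odometer s ^ 2 ^ k) ^ (2 * l)) u k = u k := by
    intro l
    induction l with
    | zero => exact fun _ _ => rfl
    | succ l ih =>
      intro u hu
      rw [mul_add, mul_one, pow_add, pow_two, Equiv.Perm.mul_apply, Equiv.Perm.mul_apply,
        ih _ (hb _ (hb _ hu)), h1 _ (hb _ hu), h1 _ hu, flip_flip]
  intro h
  obtain ⟨l, rfl⟩ := hl
  have h3 := congrFun h k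
  rw [pow_mul, pow_succ, Equiv.Perm.mul_apply, h2 _ _ (hb _ hz), h1 _ hz] at h3
  rcases eq_none_or_of_ne_other (hz k) with h | h <;> simp [h] at h3

theorem zpow_apply_injective {s : Letter} {z : Address} (hz : ∀ i, z i ≠ some s.other) :
    Function.Injective fun j : ℤ => (odometer s ^ j) z := by
  have key : ∀ i j : ℤ, i < j → (odometer s ^ i) z ≠ (odometer s ^ j) z := by
    intro i j hij h
    obtain ⟨m, hm⟩ := Int.eq_ofNat_of_zero_le (sub_nonneg.2 hij.le)
    refine pow_apply_ne hz (m := m) (by omega) ?_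
    rw [← zpow_natCast, ← hm, sub_eq_neg_add, zpow_add, Equiv.Perm.mul_apply, ← h,
      ← Equiv.Perm.mul_apply, ← zpow_add, neg_add_cancel]
    rfl
  intro i j h
  rcases lt_trichotomy i j with hij | hij | hij
  · exact absurd h (key i j hij)
  · exact hij
  · exact absurd h.symm (key j i hij)

/-- The nonzero digits of `x` are eventually equal to `s`, and the sequence of digits is not
eventually constant. -/
structure IsTame (s : Letter) (x : Address) : Prop where
  eventually : ∃ N, ∀ i ≥ N, x i ≠ some s.other
  not_const : ∀ d n, ∃ i ≥ n, x i ≠ d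

namespace IsTame

variable {s : Letter} {x : Address}

theorem ground_mem (hx : IsTame s x) {u : Address} (hu : u ∈ cofinal x) :
    ground s u ∈ cofinal x := by
  obtain ⟨N, hN⟩ := hx.eventually
  obtain ⟨n, hn⟩ := id hu
  refine tailSet_subset_cofinal hu (max n N) fun i hi => ground_of_forall fun j hj => ?_
  rw [hn j (by omega)]
  exact hN j (by omega)

theorem zpow_mem (hx : IsTame s x) (j : ℤ) : (odometer s ^ j) (ground s x) ∈ cofinal x :=
  (zpow_invariant (p := fun u => u ∈ cofinal x) (fun u => odometer_mem_cofinal hx.not_const u s)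
    j _).2 (hx.ground_mem (mem_cofinal_self x))

theorem ground_zpow (s : Letter) (x : Address) (j : ℤ) :
    ground s ((odometer s ^ j) (ground s x)) = (odometer s ^ j) (ground s x) :=
  ground_eq_self <| (zpow_invariant (p := fun u : Address => ∀ i, u i ≠ some s.other)
    (fun _ => forall_congr' fun _ => odometer_eq_other_iff.not) j _).2 (ground_ne_other s x)

theorem exists_height (hx : IsTame s x) {u : Address} (hu : u ∈ cofinal x) :
    ∃ j : ℤ, ground s u = (odometer s ^ j) (ground s x) := by
  refine exists_zpow_eq (ground_ne_other s x) (ground_ne_other s u) ?_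
  obtain ⟨m, hm⟩ := hx.ground_mem hu
  obtain ⟨n, hn⟩ := hx.ground_mem (mem_cofinal_self x)
  exact ⟨max m n, fun i hi => by rw [hm i (by omega), hn i (by omega)]⟩

end IsTame

open scoped Classical in
/-- The position of the vertex of the `s`-line at which the vertex with address `u` hangs. -/
noncomputable def height (s : Letter) (x u : Address) : ℤ :=
  if h : ∃ j : ℤ, ground s u = (odometer s ^ j) (ground s x) then h.choose else 0

namespace IsTame

variable {s : Letter} {x : Address}

theorem ground_eq_zpow (hx : IsTame s x) {u : Address} (hu : u ∈ cofinal x) :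
    ground s u = (odometer s ^ height s x u) (ground s x) := by
  have h := hx.exists_height hu
  rw [height, dif_pos h]
  exact h.choose_spec

theorem height_eq {u : Address} {j : ℤ} (h : ground s u = (odometer s ^ j) (ground s x)) :
    height s x u = j := by
  have h' : ∃ j : ℤ, ground s u = (odometer s ^ j) (ground s x) := ⟨j, h⟩
  rw [height, dif_pos h']
  exact zpow_apply_injective (ground_ne_other s x) (h'.choose_spec.symm.trans h)

theorem height_zpow (j : ℤ) : height s x ((odometer s ^ j) (ground s x)) = j :=
  height_eq (ground_zpow s x j)

/-- Only an `s`-edge that starts on the line changes the ground, and it moves it by one step. -/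
theorem height_step (hx : IsTame s x) {u : Address} (hu : u ∈ cofinal x) (t : Letter) :
    |height s x (odometer t u) - height s x u| ≤ 1 := by
  have h0 : ∀ w, ground s w = ground s u → |height s x w - height s x u| ≤ 1 := by
    intro w hw
    rw [height_eq (hw.trans (hx.ground_eq_zpow hu))]
    simp
  rcases s.eq_or_eq_other t with rfl | rfl
  · by_cases h : ∃ l, u l = some t.other
    · exact h0 _ (ground_odometer_of_exists h)
    · push Not at h
      rw [height_eq (j := 1 + height t x u)]
      · simp
      · rw [ground_odometer_of_forall h, hx.ground_eq_zpow hu, zpow_one_add]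
        rfl
  · exact h0 _ (ground_odometer_other s u)

/-- If `z` has a nonzero digit `p`, then `u` has no digit `s.other` from `p` on and agrees with `z`
there. The zero address is no ground, since `x` is not eventually `0`. -/
theorem finite_fiber (hx : IsTame s x) (z : Address) :
    {u ∈ cofinal x | ground s u = z}.Finite := by
  by_cases h : ∃ p, z p ≠ none
  · obtain ⟨p, hp⟩ := h
    refine (finite_tailSet p z).subset ?_
    rintro u ⟨-, rfl⟩ i hi
    refine (ground_of_forall fun j hj hu => hp ?_).symm
    exact ground_of_exists (hi.trans hj) hu
  · push Not at h
    refine Set.finite_empty.subset ?_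
    rintro u ⟨hu, rfl⟩
    obtain ⟨n, hn⟩ := hx.ground_mem hu
    obtain ⟨i, hi, hxi⟩ := hx.not_const none n
    exact hxi (by rw [← hn i hi, h])

/-- Induction on a bound for the positions of `s.other`. If the last one is at `m`, clear the digits
below it and step back along the `s.other`-edge; digit `m` becomes `0` and the ground is unchanged.
-/
theorem linked_ground (hx : IsTame s x) {u : Address} (hu : u ∈ cofinal x) :
    Linked {w ∈ cofinal x | ground s w = ground s u} u (ground s u) := by
  obtain ⟨m, hm⟩ : ∃ m, ∀ i ≥ m, u i ≠ some s.other := by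
    obtain ⟨N, hN⟩ := hx.eventually
    obtain ⟨n, hn⟩ := id hu
    exact ⟨max n N, fun i hi => by rw [hn i (by omega)]; exact hN i (by omega)⟩
  induction m generalizing u with
  | zero =>
    rw [ground_eq_self fun i => hm i (Nat.zero_le i)]
    exact .refl ⟨hu, ground_eq_self fun i => hm i (Nat.zero_le i)⟩
  | succ m ih =>
    by_cases hd : u m = some s.other
    · have hsub : tailSet m u ⊆ {w ∈ cofinal x | ground s w = ground s u} := by
        intro w hw
        refine ⟨tailSet_subset_cofinal hu m hw, funext fun i => ?_⟩
        by_cases hi : m ≤ i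
        · exact ground_congr (fun j hj => by rw [hw j (hi.trans hj)]) fun _ => hw i hi
        · rw [ground_of_exists (not_le.1 hi).le hd,
            ground_of_exists (not_le.1 hi).le ((hw m le_rfl).trans hd)]
      have h1 := (linked_erase m u).mono hsub
      have he : erase m u ∈ {w ∈ cofinal x | ground s w = ground s u} :=
        hsub fun i hi => by simp [erase, hi.not_gt]
      have hf := odometer_fill hd
      have hfR : fill m s.other u ∈ cofinal x := by
        rw [← odometer_mem_cofinal hx.not_const _ s.other, hf]
        exact he.1
      have hfg : ground s (fill m s.other u) = ground s u := by
        rw [← ground_odometer_other, hf, he.2]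
      have h2 : Linked {w ∈ cofinal x | ground s w = ground s u} (fill m s.other u) (erase m u) := by
        rw [← hf]
        exact .edge _ ⟨hfR, hfg⟩ (by rwa [hf])
      have h3 := ih hfR fun i hi => by
        simp only [fill, show ¬ i < m by omega, if_false]
        split_ifs
        · simp
        · exact hm i (by omega)
      rw [hfg] at h3
      exact h1.trans (h2.symm.trans h3)
    · refine ih hu fun i hi => ?_
      rcases hi.eq_or_lt with rfl | hi
      · exact hd
      · exact hm i hi

theorem linked_line {S : Set Address} {i : ℤ} {m : ℕ}
    (h : ∀ j : ℤ, i ≤ j → j ≤ i + m → (odometer s ^ j) x ∈ S) :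
    Linked S ((odometer s ^ i) x) ((odometer s ^ (i + m)) x) := by
  induction m with
  | zero => simpa using Linked.refl (h i le_rfl (by simp))
  | succ m ih =>
    have h1 := h (i + m) (by omega) (by omega)
    have h2 := h (i + (m + 1 : ℕ)) (by omega) le_rfl
    have h3 : (odometer s ^ (i + (m + 1 : ℕ))) x = odometer s ((odometer s ^ (i + m)) x) := by
      rw [← Equiv.Perm.mul_apply, ← zpow_one_add]
      congr 2
      push_cast
      ring
    rw [h3] at h2 ⊢
    exact (ih fun j hj hj' => h j hj (by omega)).trans (.edge s h1 h2)

/-- Descend to the line inside one fiber, move along the line within the interval `A`, and climb up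
in the other fiber. -/
theorem linked_of_ordConnected (hx : IsTame s x) {A : Set ℤ} (hA : A.OrdConnected) {u w : Address}
    (hu : u ∈ cofinal x) (huA : height s x u ∈ A) (hw : w ∈ cofinal x) (hwA : height s x w ∈ A) :
    Linked {u ∈ cofinal x | height s x u ∈ A} u w := by
  have h1 : ∀ u ∈ cofinal x, height s x u ∈ A → Linked {u ∈ cofinal x | height s x u ∈ A} u
      ((odometer s ^ height s x u) (ground s x)) := by
    intro u hu huA
    rw [← hx.ground_eq_zpow hu]
    refine (hx.linked_ground hu).mono ?_
    rintro w ⟨hw, hwu⟩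
    exact ⟨hw, by rwa [height_eq (hwu.trans (hx.ground_eq_zpow hu))]⟩
  have h2 : ∀ i ∈ A, ∀ j ∈ A, i ≤ j → Linked {u ∈ cofinal x | height s x u ∈ A}
      ((odometer s ^ i) (ground s x)) ((odometer s ^ j) (ground s x)) := by
    intro i hi j hj hij
    obtain ⟨m, hm⟩ := Int.eq_ofNat_of_zero_le (sub_nonneg.2 hij)
    obtain rfl : j = i + m := by omega
    exact linked_line fun k hk hk' => ⟨hx.zpow_mem k, by
      rw [height_zpow]
      exact hA.out hi hj ⟨hk, hk'⟩⟩
  refine (h1 u hu huA).trans (.trans ?_ (h1 w hw hwA).symm)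
  rcases le_total (height s x u) (height s x w) with h | h
  · exact h2 _ huA _ hwA h
  · exact (h2 _ hwA _ huA h).symm

theorem heightFunction (hx : IsTame s x) : HeightFunction (cofinal x) (height s x) where
  invariant := odometer_mem_cofinal hx.not_const
  step u hu t := hx.height_step hu t
  finite n := by
    refine ((finite_Icc (-n : ℤ) n).biUnion fun j _ =>
      hx.finite_fiber ((odometer s ^ j) (ground s x))).subset ?_
    rintro u ⟨hu, hn⟩
    exact mem_iUnion₂.2 ⟨height s x u, abs_le.1 hn, hu, hx.ground_eq_zpow hu⟩
  linked u hu w hw := linked_cofinal hu hw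
  linked_pos n u hu hun w hw hwn := hx.linked_of_ordConnected (A := {j | n < j})
    ⟨fun i hi j hj k hk => lt_of_lt_of_le hi hk.1⟩ hu hun hw hwn
  linked_neg n u hu hun w hw hwn := hx.linked_of_ordConnected (A := {j | n < -j})
    ⟨fun i hi j hj k hk => lt_of_lt_of_le hj (neg_le_neg hk.2)⟩ hu hun hw hwn
  exists_pos n := ⟨_, hx.zpow_mem (n + 1), by rw [height_zpow]; omega⟩
  exists_neg n := ⟨_, hx.zpow_mem (-(n + 1)), by rw [height_zpow]; omega⟩

end IsTame

end Schori

namespace Schori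

/-! ### The sets `𝒯𝒜_k` and `𝒯ℬ_k` -/

theorem idVertex_eq (k : ℕ) : idVertex k = Graph.vertex (toVertex k zero) := by
  rw [idVertex, toVertex_eq_mk.2 fun _ _ => (congrFun (act_one zero) _).symm]

theorem cosetPow_eq (k : ℕ) (s : Letter) (m : ℕ) :
    cosetPow k s m = Graph.vertex (toVertex k ((odometer s ^ m) zero)) := by
  rw [cosetPow, toVertex_eq_mk.2 fun _ _ => (congrFun (act_pow zero s m) _).symm]

theorem idPoint_eq : idPoint = node zero := Subtype.ext (funext idVertex_eq)

/-- The address `u` with digit `0` replaced by `s`, and the other digits below `n` by `0`. -/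
def first (s : Letter) (n : ℕ) (u : Address) : Address :=
  fun i => if i = 0 then some s else if i < n then none else u i

/-- The route of `linked_erase`, run so that a nonzero digit always remains: the digit `s` in
position `n` is traded for one in position `n - 1`, down to position `0`. This avoids the base
vertex. -/
theorem linked_first {s : Letter} {n : ℕ} {u : Address} (h : u n = some s) :
    Linked {w | ∃ i < n + 1, w i ≠ none} u (first s (n + 1) u) := by
  induction n generalizing u with
  | zero =>
    have : first s 1 u = u := by
      funext i
      simp only [first]
      split_ifs with h1 h2
      · rw [h1, h]
      · omega
      · rfl
    rw [zero_add, this]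
    exact .refl ⟨0, by simp, by simp [h]⟩
  | succ n ih =>
    have hsub : tailSet (n + 1) u ⊆ {w | ∃ i < n + 1 + 1, w i ≠ none} := fun w hw =>
      ⟨n + 1, by omega, by rw [hw (n + 1) le_rfl, h]; simp⟩
    have h1 := (linked_erase (n + 1) u).mono hsub
    have h2 : Linked {w | ∃ i < n + 1 + 1, w i ≠ none} (fill (n + 1) s u) (erase (n + 1) u) := by
      rw [← odometer_fill h]
      refine .edge s ⟨0, by omega, by simp [fill]⟩ ?_
      rw [odometer_fill h]
      exact hsub fun i hi => by simp [erase, hi.not_gt]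
    have h3 : Linked {w | ∃ i < n + 1 + 1, w i ≠ none} (fill (n + 1) s u)
        (first s (n + 1) (fill (n + 1) s u)) := by
      refine (ih (by simp [fill])).mono ?_
      rintro w ⟨i, hi, hw⟩
      exact ⟨i, by omega, hw⟩
    have h4 : first s (n + 1) (fill (n + 1) s u) = first s (n + 1 + 1) u := by
      funext i
      simp only [first, fill]
      split_ifs <;> first | rfl | omega
    rw [h4] at h3
    exact h1.trans (h2.symm.trans h3)

theorem vertex_mem_arm {s : Letter} {k : ℕ} {x : Address} (h : x k = some s) :
    Graph.vertex (toVertex (k + 1) x) ∈ arm (k + 1) s := by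
  have h1 : Graph.vertex (toVertex (k + 1) (first s (k + 1) x)) = cosetPow (k + 1) s 1 := by
    rw [cosetPow_eq]
    congr 1
    refine toVertex_eq_iff.2 fun i hi => ?_
    rw [pow_one, odometer_apply]
    by_cases h0 : i = 0
    · simp [first, h0, zero]
    · rw [if_neg fun h' => by simpa [zero] using h' 0 (by omega)]
      simp [first, h0, hi, zero]
  have hid : ∀ u : Address, (∃ i < k + 1, u i ≠ none) → toVertex (k + 1) u ≠
      toVertex (k + 1) zero := by
    rintro u ⟨i, hi, hu⟩ h'
    exact hu (toVertex_eq_iff.1 h' i hi)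
  have h2 : JoinedIn {idVertex (k + 1)}ᶜ (Graph.vertex (toVertex (k + 1) x))
      (Graph.vertex (toVertex (k + 1) (first s (k + 1) x))) := by
    refine (linked_first h).joinedIn (fun u t => Graph.continuous_edge (toVertex (k + 1) u) t)
      (fun u t => Graph.edge_zero _ _) (fun u t => ?_) (fun u t r hu hu' => ?_) (fun u hu => ?_)
    · rw [Graph.edge_one, toVertex_odometer]
    · rw [mem_compl_singleton_iff, idVertex_eq, Ne, Graph.edge_eq_vertex, ← toVertex_odometer]
      rintro (⟨-, h'⟩ | ⟨-, h'⟩)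
      exacts [hid _ hu h', hid _ hu' h']
    · rw [mem_compl_singleton_iff, idVertex_eq]
      exact fun h' => hid _ hu (Graph.vertex_injective h')
  rw [h1] at h2
  exact h2.symm

/-! ### Cut vertices of the finite graphs -/

/-- The piecewise linear extension to the graph of a function on the vertices. -/
def linear {k : ℕ} (φ : Vertex k → ℝ) : Graph k → ℝ :=
  Quot.lift (Sum.elim φ fun e => (1 - (e.2.2 : ℝ)) * φ e.1 + e.2.2 * φ (e.1.step e.2.1))
    (by rintro _ _ (⟨w, s⟩ | ⟨w, s⟩) <;> simp)

theorem linear_edge {k : ℕ} (φ : Vertex k → ℝ) (w : Vertex k) (s : Letter) (t : unitInterval) :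
    linear φ (Graph.edge w s t) = (1 - (t : ℝ)) * φ w + t * φ (w.step s) := rfl

theorem continuous_linear {k : ℕ} (φ : Vertex k → ℝ) : Continuous (linear φ) := by
  have h1 : Continuous φ := continuous_of_discreteTopology
  have h2 : Continuous fun e : Vertex k × Letter => φ (e.1.step e.2) :=
    continuous_of_discreteTopology
  have h3 : Continuous fun e : Vertex k × Letter × unitInterval => φ (e.1.step e.2.1) :=
    h2.comp (continuous_fst.prodMk (continuous_fst.comp continuous_snd))
  have h4 : Continuous fun e : Vertex k × Letter × unitInterval => (e.2.2 : ℝ) :=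
    continuous_subtype_val.comp (continuous_snd.comp continuous_snd)
  exact isQuotientMap_quot_mk.continuous_iff.2 (h1.sumElim
    (((continuous_const.sub h4).mul (h1.comp continuous_fst)).add (h4.mul h3)))

/-- By the intermediate value theorem a path from negative to positive values meets a zero of the
linear extension. Without a sign change along edges, zeros occur only at `c`, or on a loop at `c`,
where the extension would vanish identically; `hloop` excludes the latter. -/
theorem not_joinedIn_of_separated {k : ℕ} {φ : Vertex k → ℝ} {c : Vertex k}
    (hc : ∀ w, φ w = 0 → w = c) (hφ : ∀ w s, 0 ≤ φ w * φ (w.step s))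
    (hloop : ∀ s, c.step s ≠ c) {v w : Vertex k} (hv : φ v < 0) (hw : 0 < φ w) :
    ¬ JoinedIn {Graph.vertex c}ᶜ (Graph.vertex v) (Graph.vertex w) := by
  rintro ⟨γ, hγ⟩
  have hcont : Continuous fun t => linear φ (γ t) := (continuous_linear φ).comp γ.continuous
  obtain ⟨t, -, ht⟩ := isPreconnected_univ.intermediate_value (mem_univ (0 : unitInterval))
    (mem_univ (1 : unitInterval)) hcont.continuousOn
    (show (0 : ℝ) ∈ Icc (linear φ (γ 0)) (linear φ (γ 1)) by
      rw [γ.source, γ.target]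
      exact ⟨hv.le, hw.le⟩)
  refine hγ t ?_
  obtain ⟨u, s, r, hu⟩ := Graph.exists_eq_edge (γ t)
  rw [mem_singleton_iff, hu, Graph.edge_eq_vertex]
  change linear φ (γ t) = 0 at ht
  rw [hu, linear_edge] at ht
  have h0 := r.2.1
  have h1 := r.2.2
  by_cases hu0 : φ u = 0
  · by_cases hs0 : φ (u.step s) = 0
    · have h := hc _ hs0
      rw [hc u hu0] at h
      exact absurd h (hloop s)
    · rw [hu0, mul_zero, zero_add, mul_eq_zero] at ht
      exact Or.inl ⟨Subtype.ext (ht.resolve_right hs0), hc _ hu0⟩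
  · by_cases hs0 : φ (u.step s) = 0
    · rw [hs0, mul_zero, add_zero, mul_eq_zero] at ht
      have := ht.resolve_right hu0
      exact Or.inr ⟨Subtype.ext (by push_cast; linarith), hc _ hs0⟩
    · exfalso
      have hp := (hφ u s).lt_of_ne (mul_ne_zero hu0 hs0).symm
      have h2 : (1 - (r : ℝ)) * (φ u * φ u) + r * (φ u * φ (u.step s)) = 0 := by
        linear_combination φ u * ht
      have h3 : 0 < φ u * φ u := mul_self_pos.2 hu0
      rcases h0.eq_or_lt with h0 | h0
      · rw [← h0] at h2
        linarith
      · have := mul_pos h0 hp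
        have := mul_nonneg (sub_nonneg.2 h1) h3.le
        linarith

/-- The address with the digits of `u` up to the `k`-th. -/
def truncate (k : ℕ) (u : Address) : Address := fun i => if i ≤ k then u i else none

/-- The address of the vertex `s^{2^k}`. -/
def center (k : ℕ) (s : Letter) : Address := Function.update zero k (some s)

/-- The first digits of an address describe the vertex `s^{2^k}` of `Λ_{k+1}` or a vertex that
hangs there. -/
def Hangs (k : ℕ) (s : Letter) (u : Address) : Prop :=
  u k = some s ∧ ground s (truncate k u) = center k s

theorem truncate_congr {k : ℕ} {u w : Address} (h : ∀ i < k + 1, u i = w i) :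
    truncate k u = truncate k w := by
  funext i
  simp only [truncate]
  split_ifs with hi
  · exact h i (by omega)
  · rfl

theorem hangs_congr {k : ℕ} {s : Letter} {u w : Address} (h : ∀ i < k + 1, u i = w i) :
    Hangs k s u ↔ Hangs k s w := by
  rw [Hangs, Hangs, h k (by omega), truncate_congr h]

theorem truncate_odometer {k : ℕ} {t : Letter} {u : Address} {m : ℕ} (hm : m ≤ k)
    (h : u m ≠ some t) : truncate k (odometer t u) = odometer t (truncate k u) := by
  funext i
  by_cases hi : i ≤ k
  · rw [truncate, if_pos hi, odometer_apply, odometer_apply, truncate, if_pos hi]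
    congr 1
    refine propext (forall₂_congr fun j hj => ?_)
    rw [truncate, if_pos (by omega)]
  · rw [odometer_apply_of_lt (j := m) (by rwa [truncate, if_pos hm]) (by omega), truncate,
      truncate, if_neg hi, if_neg hi]

theorem hangs_odometer_other {k : ℕ} {s : Letter} {u : Address} :
    Hangs k s (odometer s.other u) ↔ Hangs k s u := by
  have h1 : odometer s.other u k = some s ↔ u k = some s := by
    have h := odometer_eq_other_iff (s := s.other) (u := u) (i := k)
    rwa [s.other_other] at h
  rw [Hangs, Hangs, h1]
  refine and_congr_right fun h => ?_
  rw [truncate_odometer le_rfl (by rw [h]; simpa using s.other_ne.symm), ground_odometer_other]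

theorem hangs_odometer_of_exists {k : ℕ} {s : Letter} {u : Address}
    (h : ∃ m < k, u m = some s.other) : Hangs k s (odometer s u) ↔ Hangs k s u := by
  obtain ⟨m, hm, hu⟩ := h
  have hu' : u m ≠ some s := by
    rw [hu]
    simpa using s.other_ne
  rw [Hangs, Hangs, odometer_apply_of_lt hu' hm, truncate_odometer hm.le hu',
    ground_odometer_of_exists ⟨m, by rw [truncate, if_pos hm.le, hu]⟩]

/-- Without a digit `s.other` below `k` the truncated word is its own ground, and so equals the
center. -/
theorem Hangs.exists_other {k : ℕ} {s : Letter} {u : Address} (h : Hangs k s u)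
    (hc : ∃ i < k + 1, u i ≠ center k s i) : ∃ m < k, u m = some s.other := by
  by_contra! hne
  obtain ⟨i, hi, hu⟩ := hc
  have hg : ground s (truncate k u) = truncate k u := by
    refine ground_eq_self fun j => ?_
    rw [truncate]
    split_ifs with hj
    · rcases hj.eq_or_lt with rfl | hj
      · rw [h.1]
        simpa using s.other_ne.symm
      · exact hne j hj
    · simp
  have := congrFun (hg.symm.trans h.2) i
  rw [truncate, if_pos (by omega)] at this
  exact hu this

theorem hangs_of_last {k m : ℕ} {s : Letter} {x : Address} (hk : x k = some s) (hm : m < k)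
    (hxm : x m = some s.other) (h0 : ∀ j, m < j → j < k → x j = none) : Hangs k s x := by
  refine ⟨hk, funext fun i => ?_⟩
  by_cases hi : i ≤ m
  · rw [ground_of_exists hi (by rw [truncate, if_pos hm.le, hxm]), center,
      Function.update_of_ne (by omega)]
    rfl
  · rw [ground_of_forall]
    · rw [truncate, center]
      rcases lt_trichotomy i k with h | rfl | h
      · rw [if_pos h.le, Function.update_of_ne h.ne, h0 i (by omega) h]
        rfl
      · rw [if_pos le_rfl, Function.update_self, hk]
      · rw [if_neg h.not_ge, Function.update_of_ne h.ne']
        rfl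
    · intro j hj
      rw [truncate]
      split_ifs with hjk
      · rcases hjk.eq_or_lt with rfl | hjk
        · rw [hk]
          simpa using s.other_ne.symm
        · rw [h0 j (by omega) hjk]
          simp
      · simp

open scoped Classical in
/-- A function on the vertices of `Λ_{k+1}` that separates the vertices that hang at `s^{2^k}` from
the remaining ones. -/
noncomputable def separator (k : ℕ) (s : Letter) (w : Vertex (k + 1)) : ℝ :=
  if Hangs k s (exists_toVertex w).choose then
    if w = toVertex (k + 1) (center k s) then 0 else 1
  else -1

open scoped Classical in
theorem separator_toVertex (k : ℕ) (s : Letter) (u : Address) :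
    separator k s (toVertex (k + 1) u) = if Hangs k s u then
      if toVertex (k + 1) u = toVertex (k + 1) (center k s) then 0 else 1 else -1 := by
  rw [separator]
  congr 1
  exact propext (hangs_congr (toVertex_eq_iff.1 (exists_toVertex (toVertex (k + 1) u)).choose_spec))

/-- An edge labelled `s.other` never changes whether a vertex hangs. An `s`-edge at a hanging vertex
other than the center does not either, because its carry is blocked below digit `k`. -/
theorem separator_mul_nonneg (k : ℕ) (s t : Letter) (w : Vertex (k + 1)) :
    0 ≤ separator k s w * separator k s (w.step t) := by
  obtain ⟨u, rfl⟩ := exists_toVertex w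
  rw [← toVertex_odometer, separator_toVertex, separator_toVertex]
  have hne : ∀ u : Address, toVertex (k + 1) u ≠ toVertex (k + 1) (center k s) →
      ∃ i < k + 1, u i ≠ center k s i := by
    intro u hu
    by_contra! h
    exact hu (toVertex_eq_iff.2 h)
  rcases s.eq_or_eq_other t with rfl | rfl
  · by_cases h1 : ∃ m < k, u m = some t.other
    · rw [hangs_odometer_of_exists h1]
      split_ifs <;> norm_num
    · have h2 : ¬ ∃ m < k, odometer t u m = some t.other := by
        simpa only [odometer_eq_other_iff] using h1
      split_ifs with h3 h4 h5 h6 h5 h6 <;> norm_num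
      · exact h1 (h3.exists_other (hne _ h4))
      · exact h2 (Hangs.exists_other ‹_› (hne _ ‹_›))
  · rw [hangs_odometer_other]
    split_ifs <;> norm_num

/-- The hypotheses say that a switch of letters occurs at digit `k`. The vertex then hangs at
`s^{2^k}`, and the separator shows that this center cuts it off from the base points of `armPlus`
and `armMinus`, which do not hang. -/
theorem vertex_mem_armT {k m : ℕ} {s : Letter} {x : Address} (hk : x k = some s) (hm : m < k)
    (hxm : x m = some s.other) (h0 : ∀ j, m < j → j < k → x j = none) :
    (node x).1 (k + 1) ∈ armT k s := by
  have hz : ∀ i < k, (zero : Address) i = none ∨ (zero : Address) i = some s := fun _ _ => Or.inl rfl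
  have hcen : cosetPow (k + 1) s (2 ^ k) = Graph.vertex (toVertex (k + 1) (center k s)) := by
    rw [cosetPow_eq, odometer_pow hz, carry_of_none rfl]
    rfl
  have hxc : toVertex (k + 1) x ≠ toVertex (k + 1) (center k s) := by
    intro h
    have := toVertex_eq_iff.1 h m (by omega)
    rw [hxm, center, Function.update_of_ne hm.ne] at this
    simp [zero] at this
  have key : ∀ u : Address, ¬ Hangs k s u → (node x).1 (k + 1) ∉
      pathComponentIn (arm (k + 1) s \ {cosetPow (k + 1) s (2 ^ k)})
        (Graph.vertex (toVertex (k + 1) u)) := by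
    intro u hu hj
    rw [hcen] at hj
    refine not_joinedIn_of_separated (φ := separator k s) (c := toVertex (k + 1) (center k s))
      ?_ (fun w t => separator_mul_nonneg k s t w) ?_ (v := toVertex (k + 1) u)
      (w := toVertex (k + 1) x) ?_ ?_ (JoinedIn.mono hj fun y hy => hy.2)
    · intro w hw
      rw [separator] at hw
      split_ifs at hw with h1 h2
      · exact h2
      · norm_num at hw
      · norm_num at hw
    -- There is no loop at the center: `m < k` makes its digit `0` vanish, and every generator flips
    -- it.
    · intro t h
      rw [← toVertex_odometer] at h
      have := toVertex_eq_iff.1 h 0 (by omega)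
      rw [odometer_apply, if_pos (by simp), center, Function.update_of_ne (by omega)] at this
      simp [zero] at this
    · rw [separator_toVertex, if_neg hu]
      norm_num
    · rw [separator_toVertex, if_pos (hangs_of_last hk hm hxm h0), if_neg hxc]
      norm_num
  refine ⟨⟨vertex_mem_arm hk, ?_⟩, ?_⟩
  · rw [mem_singleton_iff, hcen]
    exact fun h => hxc (Graph.vertex_injective h)
  · rintro (h | h)
    · rw [armPlus] at h
      rw [cosetPow_eq _ _ 1] at h
      refine key _ ?_ h
      rintro ⟨h1, -⟩
      rw [pow_one, odometer_apply, if_neg fun h' => by simpa [zero] using h' 0 (by omega)] at h1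
      simp [zero] at h1
    · rw [armMinus] at h
      rw [cosetPow_eq _ _ (2 ^ (k + 1) - 1)] at h
      refine key _ ?_ h
      -- One more step carries through the first `k + 1` digits, so they are all `s` and none is the
      -- other letter.
      have h1 : odometer s ((odometer s ^ (2 ^ (k + 1) - 1)) zero) =
          Function.update zero (k + 1) (some s) := by
        rw [← Equiv.Perm.mul_apply, ← pow_succ', Nat.sub_add_cancel Nat.one_le_two_pow,
          odometer_pow (u := zero) fun _ _ => Or.inl rfl, carry_of_none rfl]
      have h2 : ∀ j < k + 1, (odometer s ^ (2 ^ (k + 1) - 1)) zero j = some s := by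
        rw [← carry_eq_none_iff]
        intro j hj
        change odometer s _ j = none
        rw [h1, Function.update_of_ne hj.ne]
        rfl
      intro hh
      obtain ⟨i, hi, hi'⟩ := hh.exists_other ⟨0, by omega, by
        rw [h2 0 (by omega), center, Function.update_of_ne (by omega)]
        simp [zero]⟩
      rw [h2 i (by omega)] at hi'
      exact s.other_ne (by simpa using hi'.symm)

/-! ### Dyadic vertices -/

theorem exists_eventually_ne_other {x : Address} (h : (node x).IsDyadic) :
    ∃ s N, ∀ i ≥ N, x i ≠ some (Letter.other s) := by
  obtain ⟨N, hN⟩ := h.bddAbove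
  have hT : ∀ k > N, ∀ s m, x k = some s → m < k → x m = some (Letter.other s) →
      (∀ j, m < j → j < k → x j = none) → False := by
    intro k hk s m h1 h2 h3 h4
    have h5 := vertex_mem_armT h1 h2 h3 h4
    refine hk.not_ge (hN ?_)
    cases s
    exacts [Or.inl h5, Or.inr h5]
  by_cases h0 : ∃ p > N, ∃ s, x p = some s
  · obtain ⟨p, hp, s, hs⟩ := h0
    refine ⟨s, p, fun i hi => ?_⟩
    -- The invariant is that the last nonzero digit up to `i` is `s`. A next nonzero digit `s.other`
    -- would be a switch beyond the bound `N`, contradicting `hT`.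
    have key : ∃ m, m ≤ i ∧ x m = some s ∧ ∀ j, m < j → j ≤ i → x j = none := by
      induction i, hi using Nat.le_induction with
      | base => exact ⟨p, le_rfl, hs, fun j h1 h2 => absurd h1 h2.not_gt⟩
      | succ i hi ih =>
        obtain ⟨m, hm, hxm, h⟩ := ih
        rcases hd : x (i + 1) with _ | t
        · refine ⟨m, by omega, hxm, fun j h1 h2 => ?_⟩
          rcases h2.eq_or_lt with rfl | h2
          · exact hd
          · exact h j h1 (by omega)
        · rcases s.eq_or_eq_other t with rfl | rfl
          · exact ⟨i + 1, le_rfl, hd, fun j h1 h2 => absurd h1 h2.not_gt⟩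
          · exact (hT (i + 1) (by omega) s.other m hd (by omega) (by rw [s.other_other, hxm])
              fun j h1 h2 => h j h1 (by omega)).elim
    obtain ⟨m, hm, hxm, h⟩ := key
    rcases hm.eq_or_lt with rfl | hm
    · rw [hxm]
      simpa using s.other_ne.symm
    · simp [h i hm le_rfl]
  · push Not at h0
    -- All digits past `N` are `0`, so either letter serves.
    exact ⟨.a, N + 1, fun i hi => h0 i (by omega) _⟩

/-- An address that is eventually `d` lies in the leaf of `d d d ...`. For `d = 0` this is `id`; for
a letter `t`, the `t`-edge from `t t t ...` carries through all digits and ends at `id`. -/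
theorem exists_ne_of_notMem {x : Address} (h : node x ∉ pathComponent idPoint)
    (d : Option Letter) (n : ℕ) : ∃ i ≥ n, x i ≠ d := by
  by_contra! hd
  refine h ?_
  have h1 : Joined (node x) (node fun _ => d) :=
    (linked_cofinal (x := fun _ => d) ⟨n, hd⟩ (mem_cofinal_self _)).joined
  rw [idPoint_eq]
  refine Joined.symm ?_
  cases d with
  | none => exact h1
  | some t =>
    have h2 : odometer t (fun _ => some t) = zero := by
      funext i
      rw [odometer_apply, if_pos fun _ _ => rfl, flip_self]
      rfl
    have h3 := (Linked.edge (S := univ) (u := fun _ => some t) t trivial trivial).joined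
    rw [h2] at h3
    exact h1.trans h3

end Schori

theorem lemma3p4 (v : Schori.Continuum) (hv : v.IsVertex)
    (hid : v ∉ pathComponent Schori.idPoint) (hd : v.IsDyadic) :
    Nonempty (CompactExhaustion (Schori.Leaf v)) ∧
      ∀ K : CompactExhaustion (Schori.Leaf v), Nat.card (SpaceEnds.Ends K) = 2 := by
  obtain ⟨x, rfl⟩ := hv.exists_node
  obtain ⟨s, hs⟩ := Schori.exists_eventually_ne_other hd
  have hx : Schori.IsTame s x := ⟨hs, Schori.exists_ne_of_notMem hid⟩
  have h := hx.heightFunction.twoEnded (Schori.mem_cofinal_self x)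
  exact ⟨h.nonempty_exhaustion, fun K => h.card_ends K⟩
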